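/- Let $S^1=\mathbf R/\mathbf Z$ with Haar probability measure $m$ and, for $r\in S^1$, let $R_r(x)=x+r$. Let $\Sigma_2=\{0,1\}^{\mathbf Z}$ with the product topology and the shift $(\sigma s)_i=s_{i+1}$. A *Denjoy example* is an orientation preserving homeomorphism $g$ of $S^1$ with irrational rotation number for which not every orbit is dense in $S^1$; it has a unique minimal set. For an irrational $\alpha$ let $\mathcal D_\alpha$ be the set of compact subsets $D\subset\Sigma_2$ with $\sigma(D)=D$ such that $(D,\sigma)$ is topologically conjugate to $(Y,g|_Y)$, where $g$ is a Denjoy example with rotation number $\alpha$ modulo $1$ and $Y$ is its minimal set ("Denjoy minimal sets in the shift with intrinsic rotation number $\alpha$"). A nonempty proper subset $U\subset S^1$ is *regular open* if $\mathrm{Int}(\mathrm{Cl}(U))=U$. For such $U$ and $r\in S^1$ let $B=\{x\in S^1: R_r^i(x)\notin \mathrm{Fr}(U)\text{ for all }i\in\mathbf Z\}$, let $\phi:B\to\Sigma_2$ be given by $\phi(x)_i=1$ if $R_r^i(x)\in U$ and $\phi(x)_i=0$ otherwise, and put $\Lambda(U,r)=\mathrm{Cl}(\phi(B))$. If $m(\mathrm{Fr}(U))=0$,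 then $m(B)=1$, and $\lambda(U,r)=\phi_*(m)$ denotes the image measure. **Proposition 4.1.** Fix an irrational $\alpha$. Every $D\in\mathcal D_\alpha$ carries exactly one $\sigma$-invariant Borel probability measure $\mu_D$; give $\mathcal D_\alpha$ the weak topology, that is, the topology induced by $D\mapsto\mu_D$ from the topology of weak convergence of probability measures on $\Sigma_2$. Then: (a) For every natural number $n$ the space $\mathcal D_\alpha$ contains a topological ball of dimension $n$, i.e. a subspace homeomorphic to the closed unit ball of $\mathbf R^n$. (b) The set of points of $\Sigma_2$ that belong to some $D\in\mathcal D_\alpha$ is dense in $\Sigma_2$. (c) For every $D\in\mathcal D_\alpha$ there is a regular open set $U\subset S^1$ with $m(\mathrm{Fr}(U))=0$ such that $D=\Lambda(U,\alpha)$ and $\mu_D=\lambda(U,\alpha)$. In particular, under the identification of $D$ with $\mu_D$, $\mathcal D_\alpha\subset\{\lambda(U,\alpha): U \text{ regular open},\ m(\mathrm{Fr}(U))=0\}$. -/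

import Mathlib

open Set Topology MeasureTheory

noncomputable section

namespace DenjoyShift

/-! ### Minimal sets and conjugacy -/

/-- `Y` is a minimal set of the homeomorphism `h`: it is compact, nonempty, `h`-invariant, and
the full orbit of each of its points is dense in it. -/
structure IsMinimalSet {X : Type*} [TopologicalSpace X] (h : X ≃ₜ X) (Y : Set X) : Prop where
  isCompact : IsCompact Y
  nonempty : Y.Nonempty
  image_eq : h '' Y = Y
  closure_orbit : ∀ y ∈ Y, closure (range fun n : ℤ => (h ^ n) y) = Y

/-- The restrictions of `h` to the invariant set `D` and of `g` to the invariant set `Y` are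
topologically conjugate. -/
def AreConjugate {X Z : Type*} [TopologicalSpace X] [TopologicalSpace Z]
    (h : X ≃ₜ X) (D : Set X) (g : Z ≃ₜ Z) (Y : Set Z) : Prop :=
  ∃ (hD : MapsTo h D D) (hY : MapsTo g Y Y) (c : D ≃ₜ Y),
    Function.Semiconj c (hD.restrict h D D) (hY.restrict g Y Y)

/-! ### Circle homeomorphisms and Denjoy minimal sets -/

/-- `F : ℝ → ℝ` is a lift of the (orientation preserving) homeomorphism `g` of the circle
`ℝ / ℤ`. Elements of `CircleDeg1Lift` are monotone and satisfy `F (x + 1) = F x + 1`. -/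
def IsLift (F : CircleDeg1Lift) (g : UnitAddCircle ≃ₜ UnitAddCircle) : Prop :=
  Continuous F ∧ ∀ x : ℝ, ((F x : ℝ) : UnitAddCircle) = g (x : UnitAddCircle)

/-- `g` is an orientation preserving circle homeomorphism with rotation number `α` modulo `1`. -/
def HasRotationNumber (g : UnitAddCircle ≃ₜ UnitAddCircle) (α : ℝ) : Prop :=
  ∃ F : CircleDeg1Lift, IsLift F g ∧
    ((F.translationNumber : ℝ) : UnitAddCircle) = (α : UnitAddCircle)

/-- `g` is a Denjoy example with rotation number `α`: the rotation number is irrational, but `g`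
is not minimal on the whole circle. -/
structure IsDenjoyExample (g : UnitAddCircle ≃ₜ UnitAddCircle) (α : ℝ) : Prop where
  irrational : Irrational α
  hasRotationNumber : HasRotationNumber g α
  not_minimal : ¬ IsMinimalSet g univ

/-- `D` is an `h`-invariant compact set such that `(D, h)` is a Denjoy minimal set with intrinsic
rotation number `α`, i.e. it is topologically conjugate to the minimal set of a Denjoy example
with rotation number `α`. (Conjugating by a reflection of the circle shows that `α` and `-α` are
interchangeable here.) -/
structure IsDenjoyMinimalSet {X : Type*} [TopologicalSpace X] (h : X ≃ₜ X) (D : Set X) (α : ℝ) :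
    Prop where
  isCompact : IsCompact D
  image_eq : h '' D = D
  conjugate : ∃ (g : UnitAddCircle ≃ₜ UnitAddCircle) (Y : Set UnitAddCircle),
    IsDenjoyExample g α ∧ IsMinimalSet g Y ∧ AreConjugate h D g Y

/-! ### The full shift on two symbols -/

/-- The space of two-sided sequences of two symbols. -/
abbrev Sigma2 : Type := ℤ → Fin 2

/-- The shift homeomorphism. -/
def shift : Sigma2 ≃ₜ Sigma2 where
  toFun s i := s (i + 1)
  invFun s i := s (i - 1)
  left_inv s := by funext i; simp
  right_inv s := by funext i; simp
  continuous_toFun := by fun_prop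
  continuous_invFun := by fun_prop

/-- `μ` is a shift-invariant Borel probability measure carried by `Y`. -/
def IsInvariantOn (Y : Set Sigma2) (μ : ProbabilityMeasure Sigma2) : Prop :=
  MeasurePreserving shift (μ : Measure Sigma2) (μ : Measure Sigma2) ∧ (μ : Measure Sigma2) Y = 1

/-- The invariant probability measure carried by `Y`. It is meaningful for those `Y` that carry
exactly one such measure. -/
def invariantMeasure (Y : Set Sigma2) : ProbabilityMeasure Sigma2 :=
  Classical.epsilon (IsInvariantOn Y)

/-- The set of Denjoy minimal sets in the two-shift with intrinsic rotation number `α`. -/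
def DenjoySpace (α : ℝ) : Type := {D : Set Sigma2 // IsDenjoyMinimalSet shift D α}

/-- The weak topology: a Denjoy minimal set is identified with the invariant probability measure
that it carries, and probability measures are given the topology of weak convergence. -/
instance (α : ℝ) : TopologicalSpace (DenjoySpace α) :=
  TopologicalSpace.induced (fun D => invariantMeasure D.1) inferInstance

/-! ### Itineraries under a rotation with respect to a regular open set -/

/-- Regular open subsets of the circle (nonempty and proper). -/
structure IsRegularOpen (U : Set UnitAddCircle) : Prop where
  nonempty : U.Nonempty
  ne_univ : U ≠ univ
  interior_closure : interior (closure U) = U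

/-- The points whose full orbit under the rotation by `r` avoids the frontier of `U`. -/
def goodPoints (U : Set UnitAddCircle) (r : UnitAddCircle) : Set UnitAddCircle :=
  {x | ∀ i : ℤ, x + i • r ∉ frontier U}

open Classical in
/-- The itinerary of `x` under the rotation by `r` with respect to `U`. -/
def itinerary (U : Set UnitAddCircle) (r : UnitAddCircle) (x : UnitAddCircle) : Sigma2 :=
  fun i => if x + i • r ∈ U then 1 else 0

/-- The set `Λ(U, r)`: the closure of the set of itineraries of good points. -/
def Lam (U : Set UnitAddCircle) (r : UnitAddCircle) : Set Sigma2 :=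
  closure (itinerary U r '' goodPoints U r)

theorem measurable_itinerary {U : Set UnitAddCircle} (hU : MeasurableSet U) (r : UnitAddCircle) :
    Measurable (itinerary U r) := by
  classical
  refine measurable_pi_lambda _ fun i => ?_
  refine Measurable.ite ?_ measurable_const measurable_const
  exact (measurable_id.add_const (i • r)) hU

/-- The measure `λ(U, r)`: the image of Haar measure under the itinerary map, which is defined on
the set of good points (a set of full measure as soon as the frontier of `U` is null). -/
def lam (U : Set UnitAddCircle) (r : UnitAddCircle) : Measure Sigma2 :=
  ((volume : Measure UnitAddCircle).restrict (goodPoints U r)).map (itinerary U r)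

end DenjoyShift

end

open Set Topology MeasureTheory

noncomputable section

namespace DenjoyShift

/-! Poincaré's theory puts every Denjoy minimal set over an irrational rotation. A lift with
irrational translation number is semiconjugate to a translation by a monotone map, which is
continuous because its range is dense and which takes only countably many values more than once
(`exists_semiconj`). Composed with the conjugacy, this gives a map P from D to the circle that turns
the shift into the rotation and is injective outside countably many fibres
(`exists_isRotationExtension`). An invariant measure on D projects to Haar measure by unique
ergodicity, and P identifies points only over a null set, so the measure is determined
(`measure_isClosed`). For (c), let U be the set of points with no preimage starting with the symbol
0: its frontier consists of points with several preimages, and a sequence over a good point is its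
own itinerary.

For (a) and (b), Denjoy sets are built from finitely many short arcs starting at multiples jα.
Blowing up the orbits of the end points of the arcs gives a Denjoy example in whose minimal set the
arcs become clopen, so that coding by them is continuous. Coding is injective (`injOn_code`) because
a rotation matching the arcs with themselves translates the finite set of indices j into itself and
is therefore trivial (`coe_eq_zero_of_add`). The invariant measure is the image of Haar measure
under the itinerary map. It varies continuously with the lengths (`continuous_invariantMeasure`),
and lengths are read off from cylinders (`measure_cylinder`), so compactness of the ball gives an
embedding. A prescribed finite word appears in the itinerary of 0 if arcs start at jα for those j
where the word has the symbol 1. -/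

/-! ### Circle maps induced by degree one lifts -/

/-- The map of the circle induced by a degree one lift. -/
def circleMap (F : CircleDeg1Lift) : UnitAddCircle → UnitAddCircle :=
  Function.Periodic.lift (f := fun x : ℝ => ((F x : ℝ) : UnitAddCircle)) (c := 1) fun x => by
    simp [F.map_add_one]

@[simp] theorem circleMap_coe (F : CircleDeg1Lift) (x : ℝ) :
    circleMap F (x : UnitAddCircle) = ((F x : ℝ) : UnitAddCircle) := rfl

theorem continuous_circleMap {F : CircleDeg1Lift} (hF : Continuous F) :
    Continuous (circleMap F) := by
  rw [(QuotientAddGroup.isQuotientMap_mk (N := AddSubgroup.zmultiples (1 : ℝ))).continuous_iff]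
  exact (AddCircle.continuous_mk' 1).comp hF

theorem coe_eq_coe_iff {x y : ℝ} :
    (x : UnitAddCircle) = (y : UnitAddCircle) ↔ ∃ n : ℤ, x = y + n := by
  rw [← sub_eq_zero, ← AddCircle.coe_sub, AddCircle.coe_eq_zero_iff]
  constructor
  · rintro ⟨n, hn⟩
    exact ⟨n, by simp at hn; linarith⟩
  · rintro ⟨n, hn⟩
    exact ⟨n, by simp [hn]⟩

theorem coe_surjective (x : UnitAddCircle) : ∃ y : ℝ, (y : UnitAddCircle) = x :=
  QuotientAddGroup.mk_surjective x

/-! ### Irrational rotations -/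

theorem denseRange_zsmul {α : ℝ} (hα : Irrational α) :
    DenseRange fun n : ℤ => n • (α : UnitAddCircle) :=
  AddCircle.denseRange_zsmul_coe_iff.2 (by simpa using hα)

theorem exists_mem_Ioo_add {α : ℝ} (hα : Irrational α) (x : ℝ) {a b : ℝ} (hab : a < b) :
    ∃ i n : ℤ, x + i * α + n ∈ Ioo a b := by
  have hd : Dense (AddSubgroup.closure {α, 1} : Set ℝ) :=
    dense_addSubgroupClosure_pair_iff.2 (by simpa using hα)
  obtain ⟨y, hy, hy'⟩ := hd.exists_between (sub_lt_sub_right hab x)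
  rw [SetLike.mem_coe, AddSubgroup.mem_closure_pair] at hy
  obtain ⟨i, n, rfl⟩ := hy
  simp only [zsmul_eq_mul, mul_one, mem_Ioo] at hy'
  exact ⟨i, n, by constructor <;> linarith⟩

theorem exists_add_zsmul_mem {α : ℝ} (hα : Irrational α) (x : UnitAddCircle)
    {V : Set UnitAddCircle} (hV : IsOpen V) (hne : V.Nonempty) :
    ∃ i : ℤ, x + i • (α : UnitAddCircle) ∈ V := by
  have hd : DenseRange fun n : ℤ => x + n • (α : UnitAddCircle) :=
    (Homeomorph.addLeft x).surjective.denseRange.comp (denseRange_zsmul hα)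
      (Homeomorph.addLeft x).continuous
  exact hd.exists_mem_open hV hne

theorem zsmul_coe_injective {α : ℝ} (hα : Irrational α) :
    Function.Injective fun n : ℤ => n • (α : UnitAddCircle) := by
  intro a b hab
  simp only [← AddCircle.coe_zsmul, coe_eq_coe_iff, zsmul_eq_mul] at hab
  obtain ⟨n, hn⟩ := hab
  by_contra hne
  have h0 : ((a - b : ℤ) : ℝ) ≠ 0 := by exact_mod_cast sub_ne_zero.2 hne
  apply hα
  refine ⟨n / (a - b : ℤ), ?_⟩
  push_cast at h0 ⊢
  field_simp
  linarith

theorem eq_univ_of_isClosed_of_add_mem {α : ℝ} (hα : Irrational α) {K : Set UnitAddCircle}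
    (hK : IsClosed K) (hne : K.Nonempty) (h : ∀ x ∈ K, ∀ i : ℤ, x + i • (α : UnitAddCircle) ∈ K) :
    K = univ := by
  by_contra hu
  obtain ⟨x, hx⟩ := hne
  obtain ⟨i, hi⟩ := exists_add_zsmul_mem hα x hK.isOpen_compl (nonempty_compl.2 hu)
  exact hi (h x hx i)

/-- An irrational rotation is uniquely ergodic. -/
theorem eq_volume_of_map_add {α : ℝ} (hα : Irrational α) (ν : Measure UnitAddCircle)
    [IsProbabilityMeasure ν] (h : ν.map (· + (α : UnitAddCircle)) = ν) : ν = volume := by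
  have key : ∀ r : UnitAddCircle, ν.map (r + ·) = ν := by
    have hz : ∀ n : ℤ, ν.map (n • (α : UnitAddCircle) + ·) = ν := by
      have hmp : MeasurePreserving (· + (α : UnitAddCircle)) ν ν := ⟨by fun_prop, h⟩
      have hmp' : MeasurePreserving (· + -(α : UnitAddCircle)) ν ν := by
        refine ⟨by fun_prop, ?_⟩
        conv_lhs => rw [← h]
        rw [Measure.map_map (by fun_prop) (by fun_prop)]
        simp [Function.comp_def]
      intro n
      induction n using Int.induction_on with
      | zero => simp
      | succ k ih =>
        have := (hmp.comp (g := (· + (α : UnitAddCircle))) ⟨by fun_prop, ih⟩).map_eq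
        simpa [Function.comp_def, add_zsmul, add_right_comm] using this
      | pred k ih =>
        have := (hmp'.comp (g := (· + -(α : UnitAddCircle))) ⟨by fun_prop, ih⟩).map_eq
        simpa [Function.comp_def, sub_zsmul, add_right_comm, sub_eq_add_neg, add_zsmul] using this
    intro r
    have : IsProbabilityMeasure (ν.map (r + ·)) :=
      Measure.isProbabilityMeasure_map (by fun_prop)
    apply ext_of_forall_integral_eq_of_IsFiniteMeasure
    intro f
    rw [integral_map (by fun_prop) (by fun_prop)]
    -- The integral of a translate of `f` is continuous in `r` and constant on the dense orbit of
    -- `α`, hence constant; uniqueness of Haar measure then applies.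
    have hc : Continuous fun r : UnitAddCircle => ∫ x, f (r + x) ∂ν := by
      refine continuous_of_dominated (bound := fun _ => ‖f‖) (fun r => by fun_prop)
        (fun r => ae_of_all _ fun x => f.norm_coe_le_norm _) (integrable_const _)
        (ae_of_all _ fun x => by fun_prop)
    have := (denseRange_zsmul hα).equalizer hc (continuous_const (y := ∫ x, f x ∂ν)) (by
      funext n
      simp only [Function.comp]
      conv_rhs => rw [← hz n]
      rw [integral_map (by fun_prop) (by fun_prop)])
    exact congrFun this r
  have : ν.IsAddLeftInvariant := ⟨key⟩
  have := Measure.isAddLeftInvariant_eq_smul ν (volume : Measure UnitAddCircle)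
  have h1 : Measure.addHaarScalarFactor ν (volume : Measure UnitAddCircle) = 1 := by
    have h2 := congrArg (fun μ => μ univ) this
    simp at h2
    exact_mod_cast h2.symm
  rw [this, h1, one_smul]

instance : NullSingletonClass (volume : Measure UnitAddCircle) :=
  ⟨fun x => by
    rw [← Metric.closedBall_zero, AddCircle.volume_closedBall]; simp⟩

instance : IsProbabilityMeasure (volume : Measure UnitAddCircle) :=
  ⟨UnitAddCircle.measure_univ⟩

/-! ### Measures induced by itineraries -/

theorem shift_zpow_apply (n : ℤ) (s : Sigma2) (i : ℤ) : (shift ^ n) s i = s (i + n) := by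
  induction n using Int.induction_on generalizing i with
  | zero => simp
  | succ k ih =>
    rw [add_comm, zpow_add, zpow_one, Homeomorph.mul_apply]
    change (shift ^ (k : ℤ)) s (i + 1) = _
    rw [ih, add_assoc]
  | pred k ih =>
    rw [sub_eq_neg_add, zpow_add, zpow_neg_one, Homeomorph.mul_apply]
    change (shift ^ (-k : ℤ)) s (i - 1) = _
    rw [ih]; congr 1; ring

theorem itinerary_eq_one_iff {U : Set UnitAddCircle} {r x : UnitAddCircle} {i : ℤ} :
    itinerary U r x i = 1 ↔ x + i • r ∈ U := by
  classical
  unfold itinerary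
  split_ifs with h <;> simp [h]

theorem fin_two_eq_iff {a b : Fin 2} : a = b ↔ (a = 1 ↔ b = 1) := by omega

theorem shift_itinerary (U : Set UnitAddCircle) (r x : UnitAddCircle) :
    shift (itinerary U r x) = itinerary U r (x + r) := by
  funext i
  rw [fin_two_eq_iff]
  change itinerary U r x (i + 1) = 1 ↔ _
  rw [itinerary_eq_one_iff, itinerary_eq_one_iff,
    show x + (i + 1) • r = x + r + i • r by rw [add_zsmul, one_zsmul]; abel]

theorem measurePreserving_shift_map_itinerary {U : Set UnitAddCircle} (hU : MeasurableSet U)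
    (r : UnitAddCircle) :
    MeasurePreserving shift ((volume : Measure UnitAddCircle).map (itinerary U r))
      ((volume : Measure UnitAddCircle).map (itinerary U r)) := by
  have hm := measurable_itinerary hU r
  have hs : Measurable shift := shift.continuous.measurable
  refine ⟨hs, ?_⟩
  rw [Measure.map_map hs hm]
  have : (shift ∘ itinerary U r) = itinerary U r ∘ (· + r) := by
    funext x; exact shift_itinerary U r x
  rw [this, ← Measure.map_map hm (by fun_prop), map_add_right_eq_self]

theorem lam_eq_map_itinerary {U : Set UnitAddCircle} (hU : volume (frontier U) = 0)
    (r : UnitAddCircle) :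
    lam U r = (volume : Measure UnitAddCircle).map (itinerary U r) := by
  rw [lam, Measure.restrict_eq_self_of_ae_mem]
  refine ae_all_iff.2 fun i => ?_
  have h : volume ((· + i • r) ⁻¹' frontier U) = 0 := by
    rw [measure_preimage_add_right, hU]
  exact measure_eq_zero_iff_ae_notMem.1 h

/-! ### Almost one-to-one extensions of rotations -/

/-- `D` is a minimal set of the shift and `P` is a factor map from `D` onto the rotation by `α`,
all but countably many of whose fibers are singletons. -/
structure IsRotationExtension (α : ℝ) (D : Set Sigma2) (P : Sigma2 → UnitAddCircle) : Prop where
  irrational : Irrational α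
  isMinimalSet : IsMinimalSet shift D
  continuousOn : ContinuousOn P D
  map_shift : ∀ s ∈ D, P (shift s) = P s + (α : UnitAddCircle)
  countable : {x | ∃ s ∈ D, ∃ s' ∈ D, s ≠ s' ∧ P s = x ∧ P s' = x}.Countable

namespace IsRotationExtension

variable {α : ℝ} {D : Set Sigma2} {P : Sigma2 → UnitAddCircle}

theorem zpow_mem (h : IsRotationExtension α D P) {s : Sigma2} (hs : s ∈ D) (n : ℤ) :
    (shift ^ n) s ∈ D := by
  rw [← h.isMinimalSet.closure_orbit s hs]
  exact subset_closure ⟨n, rfl⟩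

theorem map_zpow (h : IsRotationExtension α D P) {s : Sigma2} (hs : s ∈ D) (n : ℤ) :
    P ((shift ^ n) s) = P s + n • (α : UnitAddCircle) := by
  induction n using Int.induction_on with
  | zero => simp
  | succ k ih =>
    rw [add_comm, zpow_add, zpow_one, Homeomorph.mul_apply, h.map_shift _ (h.zpow_mem hs _), ih,
      add_zsmul, one_zsmul]
    abel
  | pred k ih =>
    have h1 := h.map_shift _ (h.zpow_mem hs (-k - 1))
    rw [← Homeomorph.mul_apply, ← zpow_one_add, show (1 + (-(k : ℤ) - 1)) = -k by ring, ih] at h1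
    rw [sub_zsmul, one_zsmul, ← sub_eq_add_neg, ← add_sub_assoc, h1, add_sub_cancel_right]

theorem image_eq_univ (h : IsRotationExtension α D P) : P '' D = univ := by
  refine eq_univ_of_isClosed_of_add_mem h.irrational
    (h.isMinimalSet.isCompact.image_of_continuousOn h.continuousOn).isClosed
    (h.isMinimalSet.nonempty.image _) ?_
  rintro _ ⟨s, hs, rfl⟩ i
  exact ⟨_, h.zpow_mem hs i, h.map_zpow hs i⟩

/-- The points of the circle with several preimages. -/
def multiple (D : Set Sigma2) (P : Sigma2 → UnitAddCircle) : Set UnitAddCircle :=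
  {x | ∃ s ∈ D, ∃ s' ∈ D, s ≠ s' ∧ P s = x ∧ P s' = x}

theorem eq_of_notMem_multiple {s s' : Sigma2} (hs : s ∈ D) (hs' : s' ∈ D)
    (hm : P s ∉ multiple D P) (he : P s = P s') : s = s' := by
  by_contra hne
  exact hm ⟨s, hs, s', hs', hne, rfl, he.symm⟩

theorem volume_multiple (h : IsRotationExtension α D P) : volume (multiple D P) = 0 :=
  h.countable.measure_zero _

theorem exists_notMem_multiple (h : IsRotationExtension α D P) : ∃ s ∈ D, P s ∉ multiple D P := by
  by_contra! hc
  have : multiple D P = univ := by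
    rw [← univ_subset_iff, ← h.image_eq_univ]
    rintro _ ⟨s, hs, rfl⟩
    exact hc s hs
  have h0 := h.volume_multiple
  rw [this] at h0
  simp at h0

theorem zpow_notMem_multiple (h : IsRotationExtension α D P) {s : Sigma2} (hs : s ∈ D)
    (hm : P s ∉ multiple D P) (n : ℤ) : P ((shift ^ n) s) ∉ multiple D P := by
  rintro ⟨a, ha, b, hb, hab, hPa, hPb⟩
  refine hm ⟨(shift ^ (-n)) a, h.zpow_mem ha _, (shift ^ (-n)) b, h.zpow_mem hb _, ?_, ?_, ?_⟩
  · exact fun e => hab ((shift ^ (-n)).injective e)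
  · rw [h.map_zpow ha, hPa, h.map_zpow hs]; simp
  · rw [h.map_zpow hb, hPb, h.map_zpow hs]; simp

/-- One point with a singleton fibre exists, since P is onto and `multiple` is null; its whole orbit
has singleton fibres and is dense in `D`. -/
theorem exists_mem_inter (h : IsRotationExtension α D P) {V : Set Sigma2} (hV : IsOpen V)
    (hne : (V ∩ D).Nonempty) : ∃ s ∈ V ∩ D, P s ∉ multiple D P := by
  obtain ⟨s₀, hs₀, hm⟩ := h.exists_notMem_multiple
  obtain ⟨s, hsV, hsD⟩ := hne
  rw [← h.isMinimalSet.closure_orbit s₀ hs₀] at hsD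
  obtain ⟨_, htV, n, rfl⟩ := mem_closure_iff.1 hsD V hV hsV
  exact ⟨_, ⟨htV, h.zpow_mem hs₀ n⟩, h.zpow_notMem_multiple hs₀ hm n⟩

/-- The part of `D` where the symbol at the origin is `a`. -/
def cyl (D : Set Sigma2) (a : Fin 2) : Set Sigma2 := {s ∈ D | s 0 = a}

theorem isOpen_symbol (a : Fin 2) : IsOpen {s : Sigma2 | s 0 = a} :=
  (isOpen_discrete ({a} : Set (Fin 2))).preimage (continuous_apply (A := fun _ : ℤ => Fin 2) 0)

theorem isClosed_symbol (a : Fin 2) : IsClosed {s : Sigma2 | s 0 = a} :=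
  (isClosed_discrete ({a} : Set (Fin 2))).preimage (continuous_apply (A := fun _ : ℤ => Fin 2) 0)

theorem isClosed_image_cyl (h : IsRotationExtension α D P) (a : Fin 2) :
    IsClosed (P '' cyl D a) :=
  ((h.isMinimalSet.isCompact.inter_right (isClosed_symbol a)).image_of_continuousOn
    (h.continuousOn.mono inter_subset_left)).isClosed

/-- The regular open set that codes `D`. -/
def codingSet (D : Set Sigma2) (P : Sigma2 → UnitAddCircle) : Set UnitAddCircle :=
  (P '' cyl D 0)ᶜ

theorem isOpen_codingSet (h : IsRotationExtension α D P) : IsOpen (codingSet D P) :=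
  (h.isClosed_image_cyl 0).isOpen_compl

/-- Cylinders are relatively open, so points with singleton fibres are dense in each of them.
Closures and interiors of the projected cylinders can thus be tested at such points. -/
theorem exists_cyl (h : IsRotationExtension α D P) {a : Fin 2} {s : Sigma2} (hs : s ∈ cyl D a)
    {W : Set UnitAddCircle} (hW : IsOpen W) (hsW : P s ∈ W) :
    ∃ t ∈ cyl D a, P t ∈ W ∧ P t ∉ multiple D P := by
  obtain ⟨V, hV, hVW⟩ := continuousOn_iff'.1 h.continuousOn W hW
  have hsV : s ∈ V ∩ D := hVW ▸ ⟨hsW, hs.1⟩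
  obtain ⟨t, ⟨⟨htV, hta⟩, htD⟩, htm⟩ :=
    h.exists_mem_inter (hV.inter (isOpen_symbol a)) ⟨s, ⟨hsV.1, hs.2⟩, hsV.2⟩
  have : t ∈ P ⁻¹' W ∩ D := hVW.symm ▸ ⟨htV, htD⟩
  exact ⟨t, ⟨htD, hta⟩, this.1, htm⟩

theorem notMem_image_cyl {a b : Fin 2} (hab : a ≠ b) {s : Sigma2} (hs : s ∈ cyl D a)
    (hm : P s ∉ multiple D P) : P s ∉ P '' cyl D b := by
  rintro ⟨t, ht, he⟩
  have := eq_of_notMem_multiple hs.1 ht.1 hm he.symm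
  subst this
  exact hab (hs.2.symm.trans ht.2)

theorem codingSet_subset (h : IsRotationExtension α D P) : codingSet D P ⊆ P '' cyl D 1 := by
  intro x hx
  obtain ⟨s, hs, rfl⟩ := h.image_eq_univ.symm ▸ mem_univ x
  refine ⟨s, ⟨hs, ?_⟩, rfl⟩
  by_contra h1
  exact hx ⟨s, ⟨hs, by omega⟩, rfl⟩

theorem closure_codingSet (h : IsRotationExtension α D P) :
    closure (codingSet D P) = P '' cyl D 1 := by
  refine (closure_minimal h.codingSet_subset (h.isClosed_image_cyl 1)).antisymm ?_
  rintro _ ⟨s, hs, rfl⟩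
  refine mem_closure_iff.2 fun W hW hsW => ?_
  obtain ⟨t, ht, htW, htm⟩ := h.exists_cyl hs hW hsW
  exact ⟨_, htW, notMem_image_cyl (by decide) ht htm⟩

/-- If a symbol never occurred, `D` would contain a constant sequence; this fixed point of the shift
would project to a fixed point of an irrational rotation. -/
theorem symbol_nonempty (h : IsRotationExtension α D P) (a : Fin 2) : (cyl D a).Nonempty := by
  by_contra hne
  have hall : ∀ s ∈ D, ∀ i, s i ≠ a := by
    intro s hs i hi
    exact hne ⟨(shift ^ i) s, h.zpow_mem hs i, by rw [shift_zpow_apply, zero_add, hi]⟩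
  obtain ⟨s, hs⟩ := h.isMinimalSet.nonempty
  have hfix : shift s = s := by
    funext i
    have h1 := hall s hs i
    have h2 := hall s hs (i + 1)
    change s (i + 1) = s i
    omega
  have h1 := h.map_shift s hs
  rw [hfix] at h1
  have h0 : (α : UnitAddCircle) = 0 := by simpa using h1.symm
  have := zsmul_coe_injective h.irrational (a₁ := 1) (a₂ := 0) (by simp [h0])
  exact one_ne_zero this

theorem isRegularOpen_codingSet (h : IsRotationExtension α D P) :
    IsRegularOpen (codingSet D P) where
  nonempty := by
    obtain ⟨s, hs⟩ := h.symbol_nonempty 1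
    obtain ⟨t, ht, -, htm⟩ := h.exists_cyl hs isOpen_univ (mem_univ _)
    exact ⟨_, notMem_image_cyl (by decide) ht htm⟩
  ne_univ := by
    obtain ⟨s, hs⟩ := h.symbol_nonempty 0
    intro hu
    have : P s ∈ codingSet D P := hu ▸ mem_univ _
    exact this ⟨s, hs, rfl⟩
  interior_closure := by
    refine Subset.antisymm ?_ (interior_maximal subset_closure h.isOpen_codingSet)
    rw [h.closure_codingSet]
    rintro x hx ⟨s, hs, rfl⟩
    obtain ⟨t, ht, htW, htm⟩ := h.exists_cyl hs isOpen_interior hx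
    exact notMem_image_cyl (by decide) ht htm (interior_subset htW)

theorem frontier_codingSet (h : IsRotationExtension α D P) :
    frontier (codingSet D P) = P '' cyl D 1 ∩ P '' cyl D 0 := by
  rw [frontier, h.closure_codingSet, h.isOpen_codingSet.interior_eq, codingSet, sdiff_compl]

theorem frontier_subset_multiple (h : IsRotationExtension α D P) :
    frontier (codingSet D P) ⊆ multiple D P := by
  rw [h.frontier_codingSet]
  rintro _ ⟨⟨s, hs, rfl⟩, t, ht, he⟩
  refine ⟨s, hs.1, t, ht.1, ?_, rfl, he⟩
  rintro rfl
  exact absurd (hs.2.symm.trans ht.2) (by decide)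

theorem volume_frontier (h : IsRotationExtension α D P) :
    volume (frontier (codingSet D P)) = 0 :=
  measure_mono_null h.frontier_subset_multiple h.volume_multiple

/-- The frontier is the overlap of the projections of the two cylinders. Along a good orbit there is
no overlap, so the position on the circle decides the symbol. -/
theorem itinerary_eq (h : IsRotationExtension α D P) {s : Sigma2} (hs : s ∈ D)
    (hg : P s ∈ goodPoints (codingSet D P) α) : itinerary (codingSet D P) α (P s) = s := by
  funext i
  have hi := hg i
  rw [h.frontier_codingSet, ← h.map_zpow hs] at hi
  have hmem : ∀ a, s i = a → P ((shift ^ i) s) ∈ P '' cyl D a := fun a ha =>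
    ⟨_, ⟨h.zpow_mem hs i, by rw [shift_zpow_apply, zero_add, ha]⟩, rfl⟩
  rw [fin_two_eq_iff, itinerary_eq_one_iff, ← h.map_zpow hs]
  refine ⟨fun hn => ?_, fun h1 h0 => hi ⟨hmem 1 h1, h0⟩⟩
  by_contra h1
  exact hn (hmem 0 (by omega))

theorem eq_Lam (h : IsRotationExtension α D P) : D = Lam (codingSet D P) α := by
  apply Subset.antisymm
  -- A single dense orbit of points with singleton fibres suffices for this inclusion.
  · obtain ⟨s, hs, hm⟩ := h.exists_notMem_multiple
    refine (h.isMinimalSet.closure_orbit s hs).symm.subset.trans (closure_mono ?_)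
    rintro _ ⟨n, rfl⟩
    have hg : P ((shift ^ n) s) ∈ goodPoints (codingSet D P) α := by
      intro i hi
      rw [← h.map_zpow (h.zpow_mem hs n)] at hi
      exact h.zpow_notMem_multiple (h.zpow_mem hs n) (h.zpow_notMem_multiple hs hm n) i
        (h.frontier_subset_multiple hi)
    exact ⟨_, hg, h.itinerary_eq (h.zpow_mem hs n) hg⟩
  · refine closure_minimal ?_ h.isMinimalSet.isCompact.isClosed
    rintro _ ⟨x, hx, rfl⟩
    obtain ⟨s, hs, rfl⟩ := h.image_eq_univ.symm ▸ mem_univ x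
    rwa [h.itinerary_eq hs hx]

theorem exists_isInvariantOn (h : IsRotationExtension α D P) :
    ∃ μ : ProbabilityMeasure Sigma2, (μ : Measure Sigma2) = lam (codingSet D P) α ∧
      IsInvariantOn D μ := by
  have hm := measurable_itinerary h.isOpen_codingSet.measurableSet α
  have hl := lam_eq_map_itinerary h.volume_frontier α
  have hp : IsProbabilityMeasure (lam (codingSet D P) α) := by
    rw [hl]; exact Measure.isProbabilityMeasure_map hm.aemeasurable
  refine ⟨⟨_, hp⟩, rfl, ?_, ?_⟩
  · simp only [ProbabilityMeasure.coe_mk, hl]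
    exact measurePreserving_shift_map_itinerary h.isOpen_codingSet.measurableSet _
  · have hD : MeasurableSet D := h.isMinimalSet.isCompact.isClosed.measurableSet
    rw [ProbabilityMeasure.coe_mk, ← prob_compl_eq_zero_iff hD, lam,
      Measure.map_apply hm hD.compl,
      Measure.restrict_apply (hm hD.compl)]
    convert measure_empty (μ := (volume : Measure UnitAddCircle))
    rw [eq_empty_iff_forall_notMem]
    rintro x ⟨hx, hg⟩
    obtain ⟨s, hs, rfl⟩ := h.image_eq_univ.symm ▸ mem_univ x
    exact hx (show itinerary _ _ _ ∈ D by rwa [h.itinerary_eq hs hg])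

/-- The projected measure is invariant under the rotation, which is uniquely ergodic. -/
theorem map_eq_volume (h : IsRotationExtension α D P) {μ : ProbabilityMeasure Sigma2}
    (hμ : IsInvariantOn D μ) :
    AEMeasurable P (μ : Measure Sigma2) ∧ (μ : Measure Sigma2).map P = volume := by
  have hD : MeasurableSet D := h.isMinimalSet.isCompact.isClosed.measurableSet
  have hae : ∀ᵐ s ∂(μ : Measure Sigma2), s ∈ D := by
    exact measure_eq_zero_iff_ae_notMem.1 ((prob_compl_eq_zero_iff hD).2 hμ.2) |>.mono fun s hs => not_not.1 hs
  have hP : AEMeasurable P (μ : Measure Sigma2) := by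
    rw [← Measure.restrict_eq_self_of_ae_mem hae]
    exact h.continuousOn.aemeasurable hD
  refine ⟨hP, ?_⟩
  have := Measure.isProbabilityMeasure_map hP
  apply eq_volume_of_map_add h.irrational
  rw [AEMeasurable.map_map_of_aemeasurable (by fun_prop) hP]
  have h1 : (fun x => x + (α : UnitAddCircle)) ∘ P =ᵐ[(μ : Measure Sigma2)] P ∘ shift :=
    hae.mono fun s hs => (h.map_shift s hs).symm
  rw [Measure.map_congr h1, ← AEMeasurable.map_map_of_aemeasurable, hμ.1.map_eq]
  · rwa [hμ.1.map_eq]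
  · exact hμ.1.measurable.aemeasurable

/-- Off the null set of multiple fibres, `A` agrees with the full preimage of the projection of `D ∩
A`. The right-hand side does not involve `μ`, which yields uniqueness. -/
theorem measure_isClosed (h : IsRotationExtension α D P) {μ : ProbabilityMeasure Sigma2}
    (hμ : IsInvariantOn D μ) {A : Set Sigma2} (hA : IsClosed A) :
    (μ : Measure Sigma2) A = volume (P '' (D ∩ A)) := by
  obtain ⟨hP, hmap⟩ := h.map_eq_volume hμ
  have hD : MeasurableSet D := h.isMinimalSet.isCompact.isClosed.measurableSet
  have hDc : (μ : Measure Sigma2) Dᶜ = 0 := (prob_compl_eq_zero_iff hD).2 hμ.2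
  have hcl : IsClosed (P '' (D ∩ A)) :=
    ((h.isMinimalSet.isCompact.inter_right hA).image_of_continuousOn
      (h.continuousOn.mono inter_subset_left)).isClosed
  have hN : (μ : Measure Sigma2) (P ⁻¹' multiple D P) = 0 := by
    rw [← Measure.map_apply_of_aemeasurable hP (Set.Countable.measurableSet h.countable :
      MeasurableSet (multiple D P)), hmap, h.volume_multiple]
  rw [← hmap, Measure.map_apply_of_aemeasurable hP hcl.measurableSet]
  refine measure_congr ?_
  have e1 : ∀ᵐ s ∂(μ : Measure Sigma2), s ∈ D :=
    (measure_eq_zero_iff_ae_notMem.1 hDc).mono fun s hs => not_not.1 hs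
  filter_upwards [e1, measure_eq_zero_iff_ae_notMem.1 hN] with s hs hsm
  refine propext ⟨fun hsA => ⟨s, ⟨hs, hsA⟩, rfl⟩, ?_⟩
  rintro ⟨t, ⟨htD, htA⟩, he⟩
  have := eq_of_notMem_multiple hs htD hsm he.symm
  subst this
  exact htA

theorem eq_of_isInvariantOn (h : IsRotationExtension α D P) {μ ν : ProbabilityMeasure Sigma2}
    (hμ : IsInvariantOn D μ) (hν : IsInvariantOn D ν) : μ = ν := by
  apply Subtype.ext
  change (μ : Measure Sigma2) = (ν : Measure Sigma2)
  refine ext_of_generate_finite _ (BorelSpace.measurable_eq.trans borel_eq_generateFrom_isClosed)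
    isPiSystem_isClosed (fun A hA => ?_) (by simp)
  exact (h.measure_isClosed hμ hA).trans (h.measure_isClosed hν hA).symm

theorem existsUnique (h : IsRotationExtension α D P) :
    ∃! μ : ProbabilityMeasure Sigma2, IsInvariantOn D μ := by
  obtain ⟨μ, -, hμ⟩ := h.exists_isInvariantOn
  exact ⟨μ, hμ, fun ν hν => h.eq_of_isInvariantOn hν hμ⟩

theorem invariantMeasure_eq (h : IsRotationExtension α D P) {μ : ProbabilityMeasure Sigma2}
    (hμ : IsInvariantOn D μ) : invariantMeasure D = μ :=
  h.eq_of_isInvariantOn (Classical.epsilon_spec ⟨μ, hμ⟩) hμ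

theorem invariantMeasure_eq_lam (h : IsRotationExtension α D P) :
    (invariantMeasure D : Measure Sigma2) = lam (codingSet D P) α := by
  obtain ⟨μ, hl, hμ⟩ := h.exists_isInvariantOn
  rw [h.invariantMeasure_eq hμ, hl]

end IsRotationExtension

/-! ### The Poincaré semiconjugacy -/

theorem IsLift.bijective {F : CircleDeg1Lift} {g : UnitAddCircle ≃ₜ UnitAddCircle}
    (h : IsLift F g) : Function.Bijective F := by
  refine ⟨fun x y hxy => ?_, F.continuous_iff_surjective.1 h.1⟩
  have h1 : g (x : UnitAddCircle) = g (y : UnitAddCircle) := by rw [← h.2, ← h.2, hxy]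
  obtain ⟨n, rfl⟩ := coe_eq_coe_iff.1 (g.injective h1)
  rw [F.map_add_int] at hxy
  linarith

/-- A monotone map with dense range is continuous. The range contains all `H 0 + i * τ + n`;
surjectivity of `F` is what allows negative `i`. -/
theorem continuous_of_semiconj {H : CircleDeg1Lift} {F : ℝ → ℝ} (hF : Function.Surjective F)
    {τ : ℝ} (hτ : Irrational τ) (h : ∀ x, H (F x) = H x + τ) : Continuous H := by
  have hz : ∀ i : ℤ, ∃ x, H x = H 0 + i * τ := by
    intro i
    induction i using Int.induction_on with
    | zero => exact ⟨0, by simp⟩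
    | succ k ih =>
      obtain ⟨x, hx⟩ := ih
      exact ⟨F x, by rw [h, hx]; push_cast; ring⟩
    | pred k ih =>
      obtain ⟨x, hx⟩ := ih
      obtain ⟨y, rfl⟩ := hF x
      rw [h] at hx
      exact ⟨y, by rw [← sub_eq_iff_eq_add.2 hx.symm]; push_cast; ring⟩
  refine H.monotone.continuous_of_denseRange ?_
  refine dense_of_exists_between fun a b hab => ?_
  obtain ⟨i, n, hin⟩ := exists_mem_Ioo_add hτ (H 0) hab
  obtain ⟨x, hx⟩ := hz i
  exact ⟨_, ⟨x + n, rfl⟩, by rw [H.map_add_int, hx]; exact hin⟩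

/-- Distinct points with equal images have lifts which, after an integer shift, are distinct with
the same real image; a monotone function on the line has only countably many such values. -/
theorem countable_multiple_circleMap (H : CircleDeg1Lift) :
    {x | ∃ a b, a ≠ b ∧ circleMap H a = x ∧ circleMap H b = x}.Countable := by
  refine (H.monotone.countable_setOfPred_two_preimages.image
    ((↑) : ℝ → UnitAddCircle)).mono ?_
  rintro x ⟨a, b, hab, ha, hb⟩
  obtain ⟨a, rfl⟩ := coe_surjective a
  obtain ⟨b, rfl⟩ := coe_surjective b
  rw [circleMap_coe] at ha hb
  obtain ⟨n, hn⟩ := coe_eq_coe_iff.1 (ha.trans hb.symm)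
  rw [← H.map_add_int] at hn
  refine ⟨H a, ?_, ha⟩
  have hne : a ≠ b + n := fun e => hab (coe_eq_coe_iff.2 ⟨n, e⟩)
  rcases hne.lt_or_gt with h | h
  · exact ⟨_, _, h, rfl, hn.symm⟩
  · exact ⟨_, _, h, hn.symm, rfl⟩

theorem exists_semiconj {g : UnitAddCircle ≃ₜ UnitAddCircle} {α : ℝ} (hα : Irrational α)
    (hg : HasRotationNumber g α) :
    ∃ H : UnitAddCircle → UnitAddCircle, Continuous H ∧
      (∀ x, H (g x) = H x + (α : UnitAddCircle)) ∧
      {x | ∃ a b, a ≠ b ∧ H a = x ∧ H b = x}.Countable := by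
  obtain ⟨F, hF, hrot⟩ := hg
  obtain ⟨n, hn⟩ := coe_eq_coe_iff.1 hrot
  have hirr : Irrational F.translationNumber := by rw [hn]; exact hα.add_intCast n
  have hu := (CircleDeg1Lift.translate (Multiplicative.ofAdd F.translationNumber)).isUnit
  obtain ⟨H, hH⟩ := CircleDeg1Lift.semiconj_of_bijective_of_translationNumber_eq hF.bijective
    (CircleDeg1Lift.isUnit_iff_bijective.1 hu)
    (CircleDeg1Lift.translationNumber_translate _).symm
  have hH' : ∀ x, H (F x) = H x + F.translationNumber := fun x => by
    rw [hH x, CircleDeg1Lift.translate_apply, add_comm]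
  refine ⟨circleMap H, continuous_circleMap (continuous_of_semiconj hF.bijective.2 hirr hH'), ?_,
    countable_multiple_circleMap H⟩
  intro x
  obtain ⟨x, rfl⟩ := coe_surjective x
  rw [← hF.2, circleMap_coe, circleMap_coe, hH', AddCircle.coe_add, hrot]

/-! ### Transport of minimality -/

theorem zpow_mem_of_image_eq {X : Type*} [TopologicalSpace X] {h : X ≃ₜ X} {D : Set X}
    (hD : h '' D = D) {x : X} (hx : x ∈ D) (n : ℤ) : (h ^ n) x ∈ D := by
  induction n using Int.induction_on with
  | zero => simpa
  | succ k ih =>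
    rw [add_comm, zpow_add, zpow_one, Homeomorph.mul_apply, ← hD]
    exact mem_image_of_mem _ ih
  | pred k ih =>
    rw [← hD] at ih
    obtain ⟨y, hy, he⟩ := ih
    rw [sub_eq_neg_add, zpow_add, zpow_neg_one, Homeomorph.mul_apply, ← he]
    simpa using hy

theorem semiconj_zpow {X Z : Type*} [TopologicalSpace X] [TopologicalSpace Z] {h : X ≃ₜ X}
    {D : Set X} (hD : h '' D = D) {g : Z ≃ₜ Z} {c : D → Z}
    (hc : ∀ x : D, ∀ hx : h x ∈ D, c ⟨h x, hx⟩ = g (c x)) (x : D) (n : ℤ) :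
    c ⟨(h ^ n) x, zpow_mem_of_image_eq hD x.2 n⟩ = (g ^ n) (c x) := by
  induction n using Int.induction_on with
  | zero => simp
  | succ k ih =>
    have e : h ((h ^ (k : ℤ)) x) = (h ^ ((k : ℤ) + 1)) x := by
      rw [add_comm, zpow_add, zpow_one, Homeomorph.mul_apply]
    have := hc ⟨_, zpow_mem_of_image_eq hD x.2 k⟩ (e ▸ zpow_mem_of_image_eq hD x.2 _)
    rw [ih] at this
    have e2 : (g ^ ((k : ℤ) + 1)) (c x) = g ((g ^ (k : ℤ)) (c x)) := by
      rw [add_comm, zpow_add, zpow_one, Homeomorph.mul_apply]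
    rw [e2, ← this]
    congr 1
    exact Subtype.ext e.symm
  | pred k ih =>
    have e : h ((h ^ (-(k : ℤ) - 1)) x) = (h ^ (-(k : ℤ))) x := by
      rw [← Homeomorph.mul_apply, ← zpow_one_add]; congr 2; ring
    have := hc ⟨_, zpow_mem_of_image_eq hD x.2 (-k - 1)⟩ (e ▸ zpow_mem_of_image_eq hD x.2 _)
    have e2 : (g ^ (-(k : ℤ))) (c x) = g ((g ^ (-(k : ℤ) - 1)) (c x)) := by
      rw [← Homeomorph.mul_apply, ← zpow_one_add]; congr 2; ring
    apply g.injective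
    rw [← this, ← e2, ← ih]
    congr 1
    exact Subtype.ext e

/-- The conjugacy lives on subtypes while density of orbits is stated in the ambient spaces, so open
sets are carried across through the relative topologies. -/
theorem IsMinimalSet.of_conj {X Z : Type*} [TopologicalSpace X] [T2Space X] [TopologicalSpace Z]
    {h : X ≃ₜ X} {D : Set X} {g : Z ≃ₜ Z} {Y : Set Z} (hD : IsCompact D) (him : h '' D = D)
    (hY : IsMinimalSet g Y) (hc : AreConjugate h D g Y) : IsMinimalSet h D := by
  obtain ⟨hDm, hYm, c, hc⟩ := hc
  refine ⟨hD, ?_, him, fun y hy => ?_⟩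
  · obtain ⟨z, hz⟩ := hY.nonempty
    exact ⟨_, (c.symm ⟨z, hz⟩).2⟩
  · refine (closure_minimal ?_ hD.isClosed).antisymm fun s hs => ?_
    · rintro _ ⟨n, rfl⟩
      exact zpow_mem_of_image_eq him hy n
    · refine mem_closure_iff.2 fun V hV hsV => ?_
      have hop : IsOpen (c.symm ⁻¹' (Subtype.val ⁻¹' V)) :=
        (hV.preimage continuous_subtype_val).preimage c.symm.continuous
      obtain ⟨W, hW, hWV⟩ := isOpen_induced_iff.1 hop
      have hsW : c ⟨s, hs⟩ ∈ Subtype.val ⁻¹' W := by rw [hWV]; simpa using hsV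
      have hmem : (c ⟨s, hs⟩ : Z) ∈ closure (range fun n : ℤ => (g ^ n) (c ⟨y, hy⟩ : Z)) := by
        rw [hY.closure_orbit _ (c ⟨y, hy⟩).2]; exact (c ⟨s, hs⟩).2
      obtain ⟨_, hnW, n, rfl⟩ := mem_closure_iff.1 hmem W hW hsW
      have key := semiconj_zpow him (g := g) (c := fun x => (c x : Z))
        (fun x hx => congrArg Subtype.val (hc x)) ⟨y, hy⟩ n
      simp only at key hnW
      rw [← key] at hnW
      have : c ⟨(h ^ n) y, zpow_mem_of_image_eq him hy n⟩ ∈ Subtype.val ⁻¹' W := hnW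
      rw [hWV] at this
      exact ⟨_, by simpa using this, n, rfl⟩

theorem IsDenjoyMinimalSet.exists_isRotationExtension {D : Set Sigma2} {α : ℝ}
    (h : IsDenjoyMinimalSet shift D α) : ∃ P, IsRotationExtension α D P := by
  classical
  obtain ⟨g, Y, hg, hY, hc⟩ := h.conjugate
  have hmin := hY.of_conj h.isCompact h.image_eq hc
  obtain ⟨H, hH, hHg, hHc⟩ := exists_semiconj hg.irrational hg.hasRotationNumber
  obtain ⟨hDm, hYm, c, hc⟩ := hc
  -- The value 0 off `D` is arbitrary: every requirement concerns points of `D` only.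
  refine ⟨fun s => if hs : s ∈ D then H (c ⟨s, hs⟩) else 0, hg.irrational, hmin, ?_, ?_, ?_⟩
  · rw [continuousOn_iff_continuous_domRestrict]
    have : Continuous fun s : D => H (c s) := by fun_prop
    convert this using 2 with s
    simp
  · intro s hs
    have hs' : shift s ∈ D := hDm hs
    simp only [hs, hs', dif_pos]
    rw [← hHg]
    exact congrArg (fun z : Y => H z) (hc ⟨s, hs⟩)
  · refine hHc.mono ?_
    rintro x ⟨s, hs, s', hs', hne, h1, h2⟩
    simp only [hs, hs', dif_pos] at h1 h2
    refine ⟨_, _, fun e => hne ?_, h1, h2⟩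
    simpa using c.injective (Subtype.ext e)

/-! ### Blowing up a dense set of points of the circle -/

/-- Summable weights on a family of points of the circle whose lifts are dense in the line. -/
structure BlowUp (ι : Type*) where
  weight : ι → ℝ
  base : ι → ℝ
  weight_pos : ∀ i, 0 < weight i
  hasSum_weight : HasSum weight 1
  base_mem : ∀ i, base i ∈ Ico (0 : ℝ) 1
  exists_mem_Ioo : ∀ a b : ℝ, a < b → ∃ i, ∃ n : ℤ, base i + n ∈ Ioo a b

namespace BlowUp

variable {ι : Type*} (B : BlowUp ι)

/-- The lifts of the points that are blown up. -/
def support : Set ℝ := {x | ∃ i, ∃ n : ℤ, x = B.base i + n}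

theorem abs_floor_le (x : ℝ) (i : ι) : |(⌊x - B.base i⌋ : ℝ)| ≤ |x| + 2 := by
  have h := B.base_mem i
  have h1 := Int.floor_le (x - B.base i)
  have h2 := Int.lt_floor_add_one (x - B.base i)
  have h3 := neg_abs_le x
  have h4 := le_abs_self x
  rw [abs_le]
  constructor <;> linarith [h.1, h.2]

theorem abs_ceil_le (x : ℝ) (i : ι) : |((⌈x - B.base i⌉ - 1 : ℤ) : ℝ)| ≤ |x| + 2 := by
  have h := B.base_mem i
  have h1 := Int.le_ceil (x - B.base i)
  have h2 := Int.ceil_lt_add_one (x - B.base i)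
  have h3 := neg_abs_le x
  have h4 := le_abs_self x
  push_cast
  rw [abs_le]
  constructor <;> linarith [h.1, h.2]

theorem norm_weight_mul_le {z C : ℝ} (i : ι) (hz : |z| ≤ C) :
    ‖B.weight i * z‖ ≤ B.weight i * C := by
  rw [norm_mul, Real.norm_eq_abs, Real.norm_eq_abs, abs_of_pos (B.weight_pos i)]
  exact mul_le_mul_of_nonneg_left hz (B.weight_pos i).le

theorem summable_floor (x : ℝ) : Summable fun i => B.weight i * (⌊x - B.base i⌋ : ℝ) :=
  .of_norm_bounded (B.hasSum_weight.summable.mul_right (|x| + 2)) fun i =>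
    B.norm_weight_mul_le i (B.abs_floor_le x i)

theorem summable_ceil (x : ℝ) :
    Summable fun i => B.weight i * ((⌈x - B.base i⌉ - 1 : ℤ) : ℝ) :=
  .of_norm_bounded (B.hasSum_weight.summable.mul_right (|x| + 2)) fun i =>
    B.norm_weight_mul_le i (B.abs_ceil_le x i)

theorem tsum_weight_mul_add_one {f : ι → ℤ} (hf : Summable fun i => B.weight i * (f i : ℝ)) :
    ∑' i, B.weight i * ((f i + 1 : ℤ) : ℝ) = (∑' i, B.weight i * (f i : ℝ)) + 1 := by
  rw [← B.hasSum_weight.tsum_eq, ← hf.tsum_add B.hasSum_weight.summable]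
  exact tsum_congr fun i => by push_cast; ring

theorem ceil_sub_one_le_floor (x : ℝ) : ⌈x⌉ - 1 ≤ ⌊x⌋ := by
  have := Int.ceil_le_floor_add_one x
  omega

theorem floor_le_ceil_sub_one {x y : ℝ} (h : x < y) : ⌊x⌋ ≤ ⌈y⌉ - 1 := by
  rw [Int.le_sub_one_iff, Int.lt_ceil]
  exact (Int.floor_le x).trans_lt h

/-- The right end of the interval that replaces a point. -/
def upper : CircleDeg1Lift where
  -- Each floor is right-continuous and jumps by 1 exactly at the lifts of `base i`. Total weight 1
  -- makes the sum a degree one map.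
  toFun x := ∑' i, B.weight i * (⌊x - B.base i⌋ : ℝ)
  monotone' x y h := (B.summable_floor x).tsum_le_tsum (fun i =>
    mul_le_mul_of_nonneg_left (by exact_mod_cast Int.floor_mono (sub_le_sub_right h _))
      (B.weight_pos i).le) (B.summable_floor y)
  map_add_one' x := by
    rw [← B.tsum_weight_mul_add_one (B.summable_floor x)]
    refine tsum_congr fun i => ?_
    rw [← Int.floor_add_one, sub_add_eq_add_sub]

/-- The left end of the interval that replaces a point. -/
def lower : CircleDeg1Lift where
  -- `⌈t⌉ - 1` is the left limit of the floor at `t`; the two differ only when `t` is an integer.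
  toFun x := ∑' i, B.weight i * ((⌈x - B.base i⌉ - 1 : ℤ) : ℝ)
  monotone' x y h := (B.summable_ceil x).tsum_le_tsum (fun i =>
    mul_le_mul_of_nonneg_left
      (by exact_mod_cast sub_le_sub_right (Int.ceil_mono (sub_le_sub_right h _)) 1)
      (B.weight_pos i).le) (B.summable_ceil y)
  map_add_one' x := by
    rw [← B.tsum_weight_mul_add_one (B.summable_ceil x)]
    refine tsum_congr fun i => ?_
    rw [← sub_add_eq_add_sub, Int.ceil_add_one, sub_add_eq_add_sub]

theorem lower_le_upper (x : ℝ) : B.lower x ≤ B.upper x :=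
  (B.summable_ceil x).tsum_le_tsum (fun i => mul_le_mul_of_nonneg_left
    (Int.cast_le.2 (ceil_sub_one_le_floor _)) (B.weight_pos i).le) (B.summable_floor x)

/-- By density some blown-up point lies strictly between `x` and `y` and contributes a positive
jump. Hence the intervals over distinct points are disjoint and ordered. -/
theorem upper_lt_lower {x y : ℝ} (h : x < y) : B.upper x < B.lower y := by
  obtain ⟨i, n, hn⟩ := B.exists_mem_Ioo x y h
  refine Summable.tsum_lt_tsum (i := i) (fun j => mul_le_mul_of_nonneg_left
    (Int.cast_le.2 (floor_le_ceil_sub_one (sub_lt_sub_right h _))) (B.weight_pos j).le)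
    (mul_lt_mul_of_pos_left ?_ (B.weight_pos i)) (B.summable_floor x) (B.summable_ceil y)
  have h1 : ⌊x - B.base i⌋ < n := Int.floor_lt.2 (by linarith [hn.1])
  have h2 : n < ⌈y - B.base i⌉ := Int.lt_ceil.2 (by linarith [hn.2])
  exact_mod_cast (by omega : ⌊x - B.base i⌋ < ⌈y - B.base i⌉ - 1)

theorem lower_lt_upper {x : ℝ} (hx : x ∈ B.support) : B.lower x < B.upper x := by
  obtain ⟨i, n, rfl⟩ := hx
  refine Summable.tsum_lt_tsum (i := i) (fun j => mul_le_mul_of_nonneg_left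
    (Int.cast_le.2 (ceil_sub_one_le_floor _)) (B.weight_pos j).le)
    (mul_lt_mul_of_pos_left ?_ (B.weight_pos i)) (B.summable_ceil _) (B.summable_floor _)
  simp

theorem lower_eq_upper {x : ℝ} (hx : x ∉ B.support) : B.lower x = B.upper x := by
  refine tsum_congr fun i => ?_
  have h1 := ceil_sub_one_le_floor (x - B.base i)
  have h2 : ⌊x - B.base i⌋ < ⌈x - B.base i⌉ := by
    rw [Int.lt_ceil]
    refine (Int.floor_le _).lt_of_ne fun e => hx ⟨i, ⌊x - B.base i⌋, by linarith⟩
  rw [show ⌈x - B.base i⌉ - 1 = ⌊x - B.base i⌋ by omega]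

theorem eventually_abs_le (x : ℝ) : ∀ᶠ y in 𝓝 x, |y| ≤ |x| + 1 := by
  have : Filter.Tendsto (fun y : ℝ => |y|) (𝓝 x) (𝓝 |x|) := continuous_abs.continuousAt
  exact this.eventually (eventually_le_nhds (lt_add_one _))

theorem tendsto_lower (x : ℝ) : Filter.Tendsto B.lower (𝓝[<] x) (𝓝 (B.lower x)) := by
  refine tendsto_tsum_of_dominated_convergence
    (B.hasSum_weight.summable.mul_right (|x| + 1 + 2)) (fun i => ?_) ?_
  · have h1 : Filter.Tendsto (fun y => y - B.base i) (𝓝[<] x) (𝓝[≤] (x - B.base i)) := by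
      refine tendsto_nhdsWithin_iff.2 ⟨?_, ?_⟩
      · exact ((continuous_sub_right (B.base i)).tendsto x).mono_left nhdsWithin_le_nhds
      · filter_upwards [self_mem_nhdsWithin] with y hy
        exact sub_le_sub_right hy.out.le _
    have h2 := (tendsto_ceil_left_pure_ceil (x - B.base i)).comp h1
    refine tendsto_nhds_of_eventually_eq ?_
    filter_upwards [Filter.tendsto_pure.1 h2] with y hy
    simp only [Function.comp] at hy
    rw [hy]
  · filter_upwards [nhdsWithin_le_nhds (eventually_abs_le x)] with y hy i
    exact B.norm_weight_mul_le i ((B.abs_ceil_le y i).trans (by linarith))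

theorem tendsto_upper (x : ℝ) : Filter.Tendsto B.upper (𝓝[>] x) (𝓝 (B.upper x)) := by
  refine tendsto_tsum_of_dominated_convergence
    (B.hasSum_weight.summable.mul_right (|x| + 1 + 2)) (fun i => ?_) ?_
  · have h1 : Filter.Tendsto (fun y => y - B.base i) (𝓝[>] x) (𝓝[≥] (x - B.base i)) := by
      refine tendsto_nhdsWithin_iff.2 ⟨?_, ?_⟩
      · exact ((continuous_sub_right (B.base i)).tendsto x).mono_left nhdsWithin_le_nhds
      · filter_upwards [self_mem_nhdsWithin] with y hy
        exact sub_le_sub_right hy.out.le _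
    have h2 := (tendsto_floor_right_pure_floor (x - B.base i)).comp h1
    refine tendsto_nhds_of_eventually_eq ?_
    filter_upwards [Filter.tendsto_pure.1 h2] with y hy
    simp only [Function.comp] at hy
    rw [hy]
  · filter_upwards [nhdsWithin_le_nhds (eventually_abs_le x)] with y hy i
    exact B.norm_weight_mul_le i ((B.abs_floor_le y i).trans (by linarith))

/-- The intervals cover the line: at the supremum of the points whose left end is at most `y`, left
continuity of `lower` and right continuity of `upper` give the two bounds. -/
theorem exists_mem_Icc (y : ℝ) : ∃ x, y ∈ Icc (B.lower x) (B.upper x) := by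
  have hne : {x | B.lower x ≤ y}.Nonempty :=
    (B.lower.tendsto_atBot.eventually (Filter.eventually_le_atBot y)).exists
  obtain ⟨M, hM⟩ := (B.lower.tendsto_atTop.eventually (Filter.eventually_gt_atTop y)).exists
  have hbdd : BddAbove {x | B.lower x ≤ y} := ⟨M, fun x hx => by
    by_contra! hc
    exact absurd (B.lower.monotone hc.le) (not_le.2 (lt_of_le_of_lt hx hM))⟩
  refine ⟨sSup {x | B.lower x ≤ y}, ?_, ?_⟩
  · refine le_of_tendsto (B.tendsto_lower _) ?_
    filter_upwards [self_mem_nhdsWithin] with z hz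
    obtain ⟨x, hx, hzx⟩ := exists_lt_of_lt_csSup hne hz
    exact (B.lower.monotone hzx.le).trans hx
  · refine ge_of_tendsto (B.tendsto_upper _) ?_
    filter_upwards [self_mem_nhdsWithin] with z hz
    refine le_trans (le_of_not_ge fun hc => ?_) (B.lower_le_upper z)
    exact absurd (le_csSup hbdd hc) (not_le.2 hz)

theorem eq_of_mem_Icc {x x' y : ℝ} (h : y ∈ Icc (B.lower x) (B.upper x))
    (h' : y ∈ Icc (B.lower x') (B.upper x')) : x = x' := by
  rcases lt_trichotomy x x' with hlt | heq | hlt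
  · exact absurd (B.upper_lt_lower hlt) (not_lt.2 (h'.1.trans h.2))
  · exact heq
  · exact absurd (B.upper_lt_lower hlt) (not_lt.2 (h.1.trans h'.2))

theorem add_int_mem_Icc {x y : ℝ} (h : y ∈ Icc (B.lower x) (B.upper x)) (n : ℤ) :
    y + n ∈ Icc (B.lower (x + n)) (B.upper (x + n)) := by
  rw [B.lower.map_add_int, B.upper.map_add_int]
  exact ⟨by linarith [h.1], by linarith [h.2]⟩

/-- The map that collapses the intervals inserted by the blow-up. -/
def collapse : CircleDeg1Lift where
  toFun y := (B.exists_mem_Icc y).choose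
  monotone' y y' h := by
    by_contra! hc
    have h1 := (B.exists_mem_Icc y).choose_spec
    have h2 := (B.exists_mem_Icc y').choose_spec
    exact absurd (B.upper_lt_lower hc) (not_lt.2 (h1.1.trans (h.trans h2.2)))
  map_add_one' y := by
    refine B.eq_of_mem_Icc (B.exists_mem_Icc (y + 1)).choose_spec ?_
    exact_mod_cast B.add_int_mem_Icc (B.exists_mem_Icc y).choose_spec 1

theorem mem_Icc_collapse (y : ℝ) :
    y ∈ Icc (B.lower (B.collapse y)) (B.upper (B.collapse y)) :=
  (B.exists_mem_Icc y).choose_spec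

theorem collapse_eq {x y : ℝ} (h : y ∈ Icc (B.lower x) (B.upper x)) : B.collapse y = x :=
  B.eq_of_mem_Icc (B.mem_Icc_collapse y) h

@[simp] theorem collapse_lower (x : ℝ) : B.collapse (B.lower x) = x :=
  B.collapse_eq ⟨le_rfl, B.lower_le_upper x⟩

@[simp] theorem collapse_upper (x : ℝ) : B.collapse (B.upper x) = x :=
  B.collapse_eq ⟨B.lower_le_upper x, le_rfl⟩

/-! ### The Denjoy homeomorphism -/

/-- The blown up set is invariant under translation by `β`. -/
def Invariant (β : ℝ) : Prop := ∀ x, x + β ∈ B.support ↔ x ∈ B.support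

theorem Invariant.neg {B : BlowUp ι} {β : ℝ} (h : B.Invariant β) : B.Invariant (-β) := fun x => by
  rw [← h (x + -β), neg_add_cancel_right]

/-- The length of the interval that replaces a point. -/
def jump (x : ℝ) : ℝ := B.upper x - B.lower x

theorem jump_nonneg (x : ℝ) : 0 ≤ B.jump x := sub_nonneg.2 (B.lower_le_upper x)

theorem jump_pos_iff {x : ℝ} : 0 < B.jump x ↔ x ∈ B.support := by
  refine ⟨fun h => ?_, fun h => sub_pos.2 (B.lower_lt_upper h)⟩
  by_contra hc
  rw [jump, B.lower_eq_upper hc, sub_self] at h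
  exact h.false

theorem jump_eq_zero_iff {x : ℝ} : B.jump x = 0 ↔ x ∉ B.support := by
  rw [← B.jump_pos_iff, not_lt]
  exact ⟨le_of_eq, fun h => h.antisymm (B.jump_nonneg x)⟩

/-- The translation by `β`, extended affinely to the inserted intervals. -/
def moveFun (β y : ℝ) : ℝ :=
  B.lower (B.collapse y + β) +
    -- Outside the support the first factor vanishes, so the quotient by a zero jump is harmless.
    (y - B.lower (B.collapse y)) * (B.jump (B.collapse y + β) / B.jump (B.collapse y))

variable {B}

theorem moveFun_mem_Icc (β y : ℝ) :
    B.moveFun β y ∈ Icc (B.lower (B.collapse y + β)) (B.upper (B.collapse y + β)) := by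
  obtain ⟨h1, h2⟩ := B.mem_Icc_collapse y
  rw [moveFun]
  refine ⟨le_add_of_nonneg_right (mul_nonneg (sub_nonneg.2 h1)
    (div_nonneg (B.jump_nonneg _) (B.jump_nonneg _))), ?_⟩
  have : (y - B.lower (B.collapse y)) * (B.jump (B.collapse y + β) / B.jump (B.collapse y)) ≤
      B.jump (B.collapse y + β) := by
    by_cases hs : B.collapse y ∈ B.support
    · have hp := B.jump_pos_iff.2 hs
      rw [← mul_div_assoc, div_le_iff₀ hp, mul_comm]
      refine mul_le_mul_of_nonneg_left ?_ (B.jump_nonneg _)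
      rw [jump]; linarith
    · rw [B.jump_eq_zero_iff.2 hs]; simp [B.jump_nonneg]
  have e : B.upper (B.collapse y + β) = B.lower (B.collapse y + β) + B.jump (B.collapse y + β) := by
    rw [jump]; ring
  linarith

theorem collapse_moveFun (β y : ℝ) :
    B.collapse (B.moveFun β y) = B.collapse y + β :=
  B.collapse_eq (moveFun_mem_Icc β y)

/-- Invariance makes both jumps positive or both zero; in the first case the two affine slopes are
reciprocal, in the second the interval is a point. -/
theorem moveFun_neg_moveFun {β : ℝ} (h : B.Invariant β) (y : ℝ) :
    B.moveFun (-β) (B.moveFun β y) = y := by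
  conv_lhs => rw [moveFun, collapse_moveFun, add_neg_cancel_right, moveFun, add_sub_cancel_left]
  by_cases hs : B.collapse y ∈ B.support
  · have hp := (B.jump_pos_iff.2 hs).ne'
    have hp' := (B.jump_pos_iff.2 ((h _).2 hs)).ne'
    field_simp
    ring
  · have := B.lower_eq_upper hs
    obtain ⟨h1, h2⟩ := B.mem_Icc_collapse y
    rw [B.jump_eq_zero_iff.2 hs]
    simp only [zero_div, mul_zero, add_zero]
    linarith

theorem moveFun_lower {β : ℝ} (x : ℝ) : B.moveFun β (B.lower x) = B.lower (x + β) := by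
  simp [moveFun]

theorem moveFun_upper {β : ℝ} (h : B.Invariant β) (x : ℝ) :
    B.moveFun β (B.upper x) = B.upper (x + β) := by
  rw [moveFun, collapse_upper]
  by_cases hs : x ∈ B.support
  · have hp := (B.jump_pos_iff.2 hs).ne'
    rw [show B.upper x - B.lower x = B.jump x from rfl, mul_div_cancel₀ _ hp, jump]
    ring
  · rw [B.lower_eq_upper hs, sub_self, zero_mul, add_zero,
      B.lower_eq_upper (fun hc => hs ((h x).1 hc))]

theorem monotone_moveFun (β : ℝ) : Monotone (B.moveFun β) := by
  intro y y' hy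
  rcases (B.collapse.monotone hy).eq_or_lt with heq | hlt
  · rw [moveFun, moveFun, heq]
    gcongr
    exact div_nonneg (B.jump_nonneg _) (B.jump_nonneg _)
  · exact ((moveFun_mem_Icc β y).2.trans
      (B.upper_lt_lower (add_lt_add_left hlt β)).le).trans (moveFun_mem_Icc β y').1

variable (B) in
/-- The lift of the Denjoy homeomorphism. -/
def move (β : ℝ) : CircleDeg1Lift where
  toFun := B.moveFun β
  monotone' := monotone_moveFun β
  map_add_one' y := by
    have e : ∀ x, B.jump (x + 1) = B.jump x := fun x => by
      rw [jump, B.upper.map_add_one, B.lower.map_add_one, jump]; ring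
    rw [moveFun, B.collapse.map_add_one, add_right_comm, B.lower.map_add_one,
      B.lower.map_add_one, e, e, moveFun]
    ring

theorem move_apply (β y : ℝ) : B.move β y = B.moveFun β y := rfl

theorem move_neg_move {β : ℝ} (h : B.Invariant β) (y : ℝ) : B.move (-β) (B.move β y) = y :=
  moveFun_neg_moveFun h y

theorem move_move_neg {β : ℝ} (h : B.Invariant β) (y : ℝ) : B.move β (B.move (-β) y) = y := by
  have := moveFun_neg_moveFun h.neg y
  rwa [neg_neg] at this

theorem continuous_move {β : ℝ} (h : B.Invariant β) : Continuous (B.move β) :=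
  (B.move β).continuous_iff_surjective.2 fun y => ⟨_, move_move_neg h y⟩

/-- The Denjoy homeomorphism of the circle. -/
def homeo {β : ℝ} (h : B.Invariant β) : UnitAddCircle ≃ₜ UnitAddCircle where
  toFun := circleMap (B.move β)
  invFun := circleMap (B.move (-β))
  left_inv x := by
    obtain ⟨x, rfl⟩ := coe_surjective x
    simp [move_neg_move h]
  right_inv x := by
    obtain ⟨x, rfl⟩ := coe_surjective x
    simp [move_move_neg h]
  continuous_toFun := continuous_circleMap (continuous_move h)
  continuous_invFun := continuous_circleMap (continuous_move h.neg)

theorem homeo_coe {β : ℝ} (h : B.Invariant β) (y : ℝ) :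
    homeo h (y : UnitAddCircle) = ((B.moveFun β y : ℝ) : UnitAddCircle) := rfl

theorem hasRotationNumber_homeo {β : ℝ} (h : B.Invariant β) :
    HasRotationNumber (homeo h) β := by
  refine ⟨B.move β, ⟨continuous_move h, fun _ => rfl⟩, ?_⟩
  have : Function.Semiconj B.collapse (B.move β)
      (CircleDeg1Lift.translate (Multiplicative.ofAdd β) : CircleDeg1Lift) := fun y => by
    rw [CircleDeg1Lift.translate_apply, move_apply, collapse_moveFun, add_comm]
  rw [CircleDeg1Lift.translationNumber_eq_of_semiconj this,
    CircleDeg1Lift.translationNumber_translate]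

variable (B) in
/-- The complement of the inserted open intervals. -/
def minimalSet : Set UnitAddCircle :=
  (((↑) : ℝ → UnitAddCircle) '' ⋃ x, Ioo (B.lower x) (B.upper x))ᶜ

theorem isOpenMap_coe : IsOpenMap ((↑) : ℝ → UnitAddCircle) :=
  QuotientAddGroup.isOpenMap_coe

theorem isClosed_minimalSet : IsClosed B.minimalSet :=
  (isOpenMap_coe _ (isOpen_iUnion fun _ => isOpen_Ioo)).isClosed_compl

theorem coe_mem_minimalSet {y : ℝ} : (y : UnitAddCircle) ∈ B.minimalSet ↔
    y = B.lower (B.collapse y) ∨ y = B.upper (B.collapse y) := by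
  obtain ⟨h1, h2⟩ := B.mem_Icc_collapse y
  constructor
  · intro h
    by_contra! hc
    exact h ⟨y, mem_iUnion.2 ⟨_, h1.lt_of_ne hc.1.symm, h2.lt_of_ne hc.2⟩, rfl⟩
  · rintro h ⟨z, hz, he⟩
    obtain ⟨x, hx⟩ := mem_iUnion.1 hz
    obtain ⟨n, rfl⟩ := coe_eq_coe_iff.1 he.symm
    have hc : B.collapse z = x := B.collapse_eq ⟨hx.1.le, hx.2.le⟩
    rw [B.collapse.map_add_int, hc, B.lower.map_add_int, B.upper.map_add_int] at h
    rcases h with h | h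
    · linarith [hx.1]
    · linarith [hx.2]

theorem coe_lower_mem (x : ℝ) : (B.lower x : UnitAddCircle) ∈ B.minimalSet :=
  coe_mem_minimalSet.2 (by simp)

theorem coe_upper_mem (x : ℝ) : (B.upper x : UnitAddCircle) ∈ B.minimalSet :=
  coe_mem_minimalSet.2 (by simp)

theorem exists_of_mem_minimalSet {y : UnitAddCircle} (hy : y ∈ B.minimalSet) :
    ∃ x : ℝ, y = (B.lower x : UnitAddCircle) ∨ y = (B.upper x : UnitAddCircle) := by
  obtain ⟨y, rfl⟩ := coe_surjective y
  refine ⟨B.collapse y, (coe_mem_minimalSet.1 hy).imp ?_ ?_⟩ <;> exact congrArg _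

theorem mapsTo_homeo {β : ℝ} (h : B.Invariant β) :
    MapsTo (homeo h) B.minimalSet B.minimalSet := by
  intro y hy
  obtain ⟨x, rfl | rfl⟩ := exists_of_mem_minimalSet hy
  · rw [homeo_coe, moveFun_lower]; exact coe_lower_mem _
  · rw [homeo_coe, moveFun_upper h]; exact coe_upper_mem _

theorem image_homeo {β : ℝ} (h : B.Invariant β) :
    homeo h '' B.minimalSet = B.minimalSet := by
  refine (mapsTo_homeo h).image_subset.antisymm fun y hy => ⟨(homeo h).symm y, ?_, by simp⟩
  exact mapsTo_homeo h.neg hy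

theorem map_zpow_of_map {X : Type*} [TopologicalSpace X] {g : X ≃ₜ X} {P : X → UnitAddCircle}
    {r : UnitAddCircle} (h : ∀ x, P (g x) = P x + r) (x : X) (n : ℤ) :
    P ((g ^ n) x) = P x + n • r := by
  induction n using Int.induction_on with
  | zero => simp
  | succ k ih =>
    rw [add_comm, zpow_add, zpow_one, Homeomorph.mul_apply, h, ih, add_zsmul, one_zsmul]
    abel
  | pred k ih =>
    have h1 := h ((g ^ (-k - 1 : ℤ)) x)
    rw [← Homeomorph.mul_apply, ← zpow_one_add, show (1 + (-(k : ℤ) - 1)) = -k by ring, ih] at h1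
    rw [sub_zsmul, one_zsmul, ← sub_eq_add_neg, ← add_sub_assoc, h1, add_sub_cancel_right]

theorem circleMap_collapse_homeo {β : ℝ} (h : B.Invariant β) (y : UnitAddCircle) :
    circleMap B.collapse (homeo h y) = circleMap B.collapse y + (β : UnitAddCircle) := by
  obtain ⟨y, rfl⟩ := coe_surjective y
  rw [homeo_coe, circleMap_coe, circleMap_coe, collapse_moveFun, AddCircle.coe_add]

/-- Collapsing turns orbits of the homeomorphism into orbits of the rotation, which are dense. -/
theorem exists_zpow_eq_coe {β : ℝ} (hβ : Irrational β) (h : B.Invariant β) (y : UnitAddCircle)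
    {a b : ℝ} (hab : a < b) : ∃ n : ℤ, ∃ z : ℝ, (homeo h ^ n) y = z ∧ B.collapse z ∈ Ioo a b := by
  obtain ⟨n, t, ht, he⟩ := exists_add_zsmul_mem hβ (circleMap B.collapse y)
    (isOpenMap_coe _ isOpen_Ioo) ((nonempty_Ioo.2 hab).image _)
  rw [← map_zpow_of_map (circleMap_collapse_homeo h)] at he
  obtain ⟨z, hz⟩ := coe_surjective ((homeo h ^ n) y)
  rw [← hz, circleMap_coe] at he
  obtain ⟨m, rfl⟩ := coe_eq_coe_iff.1 he
  refine ⟨n, z + m, ?_, by rwa [B.collapse.map_add_int]⟩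
  rw [← hz]
  exact coe_eq_coe_iff.2 ⟨-m, by push_cast; ring⟩

theorem isMinimalSet_homeo {β : ℝ} (hβ : Irrational β) (h : B.Invariant β) :
    IsMinimalSet (homeo h) B.minimalSet where
  isCompact := isClosed_minimalSet.isCompact
  nonempty := ⟨_, coe_lower_mem 0⟩
  image_eq := image_homeo h
  closure_orbit y hy := by
    refine (closure_minimal ?_ isClosed_minimalSet).antisymm fun y' hy' => ?_
    · rintro _ ⟨n, rfl⟩
      exact zpow_mem_of_image_eq (image_homeo h) hy n
    refine mem_closure_iff.2 fun V hV hyV => ?_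
    have hV' : IsOpen (((↑) : ℝ → UnitAddCircle) ⁻¹' V) := hV.preimage (AddCircle.continuous_mk' 1)
    obtain ⟨x, rfl | rfl⟩ := exists_of_mem_minimalSet hy'
    · obtain ⟨ε, hε, hball⟩ := Metric.isOpen_iff.1 hV' _ hyV
      -- Left ends are approximated from the left and right ends from the right. An orbit point that
      -- collapses strictly between these two values lies within `ε` of `lower x`.
      have hlt : B.collapse (B.lower x - ε) < x := by
        by_contra! hc
        linarith [B.lower.monotone hc, (B.mem_Icc_collapse (B.lower x - ε)).1]
      obtain ⟨n, z, hz, hz1, hz2⟩ := exists_zpow_eq_coe hβ h y hlt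
      refine ⟨_, ?_, n, rfl⟩
      simp only [hz]
      refine hball ?_
      rw [Real.ball_eq_Ioo]
      refine ⟨lt_of_not_ge fun hc => absurd (B.collapse.monotone hc) (not_le.2 hz1), ?_⟩
      linarith [(B.mem_Icc_collapse z).2, B.upper_lt_lower hz2]
    · obtain ⟨ε, hε, hball⟩ := Metric.isOpen_iff.1 hV' _ hyV
      have hlt : x < B.collapse (B.upper x + ε) := by
        by_contra! hc
        linarith [B.upper.monotone hc, (B.mem_Icc_collapse (B.upper x + ε)).2]
      obtain ⟨n, z, hz, hz1, hz2⟩ := exists_zpow_eq_coe hβ h y hlt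
      refine ⟨_, ?_, n, rfl⟩
      simp only [hz]
      refine hball ?_
      rw [Real.ball_eq_Ioo]
      refine ⟨?_, lt_of_not_ge fun hc => absurd (B.collapse.monotone hc) (not_le.2 hz2)⟩
      linarith [(B.mem_Icc_collapse z).1, B.upper_lt_lower hz1]

theorem isDenjoyExample_homeo {β : ℝ} (hβ : Irrational β) (h : B.Invariant β) :
    IsDenjoyExample (homeo h) β where
  irrational := hβ
  hasRotationNumber := hasRotationNumber_homeo h
  not_minimal hm := by
    have hmin := isMinimalSet_homeo hβ h
    have hu : B.minimalSet = univ := by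
      obtain ⟨y, hy⟩ := hmin.nonempty
      rw [← hmin.closure_orbit y hy, hm.closure_orbit y (mem_univ y)]
    obtain ⟨i, n, -⟩ := B.exists_mem_Ioo 0 1 one_pos
    obtain ⟨z, hz⟩ := exists_between (B.lower_lt_upper ⟨i, n, rfl⟩)
    have : (z : UnitAddCircle) ∈ B.minimalSet := hu ▸ mem_univ _
    exact this ⟨z, mem_iUnion.2 ⟨_, hz⟩, rfl⟩

end BlowUp

/-! ### Systems of arcs starting on one orbit of an irrational rotation -/

/-- The multiples of `α` with coefficients up to `K` are `δ`-separated on the circle. -/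
def IsSeparated (α : ℝ) (K : ℤ) (δ : ℝ) : Prop :=
  ∀ k n : ℤ, |k| ≤ K → |k * α + n| < δ → k = 0 ∧ n = 0

/-- Only finitely many nonzero `k` occur, each with `k * α` at positive distance from the integers;
`δ < 1` settles `k = 0`. -/
theorem exists_isSeparated {α : ℝ} (hα : Irrational α) (K : ℤ) :
    ∃ δ : ℝ, 0 < δ ∧ δ < 1 ∧ IsSeparated α K δ := by
  have h : ∀ᶠ δ : ℝ in 𝓝[>] 0, ∀ k ∈ (Finset.Icc (-K) K).filter (· ≠ 0),
      δ < |k * α - round (k * α)| := by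
    refine (Filter.eventually_all_finset _).2 fun k hk => ?_
    refine nhdsWithin_le_nhds (eventually_lt_nhds ?_)
    rw [abs_pos, sub_ne_zero]
    exact (hα.intCast_mul (Finset.mem_filter.1 hk).2).ne_int _
  obtain ⟨δ, ⟨hδ, hδ1⟩, hδ0⟩ := (h.and (nhdsWithin_le_nhds
    (eventually_lt_nhds (zero_lt_one' ℝ))) |>.and self_mem_nhdsWithin).exists
  refine ⟨δ, hδ0, hδ1, fun k n hk hkn => ?_⟩
  have hk0 : k = 0 := by
    by_contra hk0
    have h1 := hδ k (Finset.mem_filter.2 ⟨Finset.mem_Icc.2 (abs_le.1 hk), hk0⟩)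
    have h2 := round_le (k * α) (-n)
    push_cast at h2
    rw [sub_neg_eq_add] at h2
    linarith
  subst hk0
  refine ⟨rfl, ?_⟩
  rw [Int.cast_zero, zero_mul, zero_add] at hkn
  have : |(n : ℝ)| < 1 := hkn.trans hδ1
  exact Int.abs_lt_one_iff.1 (by exact_mod_cast this)

/-- Finitely many short arcs of the circle whose starting points are multiples of `α`. -/
structure ArcSystem (α : ℝ) where
  irrational : Irrational α
  gap : ℝ
  gap_pos : 0 < gap
  gap_lt_one : gap < 1
  index : Finset ℤ
  index_nonempty : index.Nonempty
  length : ℤ → ℝ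
  length_pos : ∀ j ∈ index, 0 < length j
  -- Half the separation of the starting points: the closed arcs are disjoint, and free space
  -- precedes each starting point.
  length_le : ∀ j ∈ index, length j ≤ gap / 2
  separated : ∀ i ∈ index, ∀ j ∈ index, ∀ n : ℤ, |(i - j) * α + n| < gap → i = j ∧ n = 0

/-- The points in dense position given by countably many base points can be blown up. -/
theorem BlowUp.exists_of_dense {ι : Type*} [Encodable ι] (b : ι → ℝ)
    (hb : ∀ x y : ℝ, x < y → ∃ i, ∃ n : ℤ, b i + n ∈ Ioo x y) :
    ∃ B : BlowUp ι, B.support = {x | ∃ i, ∃ n : ℤ, x = b i + n} := by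
  obtain ⟨w, hw, c, hc, -⟩ := posSumOfEncodable one_pos ι
  obtain ⟨i₀, -⟩ := hb 0 1 one_pos
  have hc0 : 0 < c := (hw i₀).trans_le (le_hasSum hc i₀ fun j _ => (hw j).le)
  refine ⟨⟨fun i => w i / c, fun i => Int.fract (b i), fun i => div_pos (hw i) hc0, ?_,
    fun i => ⟨Int.fract_nonneg _, Int.fract_lt_one _⟩, fun x y hxy => ?_⟩, ?_⟩
  · simpa [hc0.ne'] using hc.div_const c
  · obtain ⟨i, n, hin⟩ := hb x y hxy
    refine ⟨i, n + ⌊b i⌋, ?_⟩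
    rw [Int.fract]
    push_cast
    convert hin using 1
    ring
  · ext x
    constructor
    · rintro ⟨i, n, rfl⟩
      exact ⟨i, n - ⌊b i⌋, by simp only [Int.fract]; push_cast; ring⟩
    · rintro ⟨i, n, rfl⟩
      exact ⟨i, n + ⌊b i⌋, by simp only [Int.fract]; push_cast; ring⟩

theorem coe_mem_image_coe {x : ℝ} {T : Set ℝ} :
    (x : UnitAddCircle) ∈ ((↑) : ℝ → UnitAddCircle) '' T ↔ ∃ n : ℤ, x + n ∈ T := by
  constructor
  · rintro ⟨t, ht, he⟩
    obtain ⟨n, rfl⟩ := coe_eq_coe_iff.1 he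
    exact ⟨n, ht⟩
  · rintro ⟨n, hn⟩
    exact ⟨_, hn, coe_eq_coe_iff.2 ⟨n, rfl⟩⟩

namespace ArcSystem

variable {α : ℝ} (S : ArcSystem α)

/-- The end points of the arcs, up to the rotation. -/
def endpoint : Option ℤ → ℝ
  -- All starting points lie on the orbit of 0, so one entry serves them all; indices outside
  -- `S.index` merely repeat it.
  | none => 0
  | some j => if j ∈ S.index then S.length j else 0

theorem exists_blowUp : ∃ B : BlowUp (Option ℤ × ℤ),
    B.support = {x | ∃ i : Option ℤ × ℤ, ∃ n : ℤ, x = S.endpoint i.1 + i.2 * α + n} :=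
  BlowUp.exists_of_dense (fun i : Option ℤ × ℤ => S.endpoint i.1 + i.2 * α) fun x y hxy => by
    obtain ⟨k, n, hkn⟩ := exists_mem_Ioo_add S.irrational 0 hxy
    exact ⟨(none, k), n, by simpa [endpoint] using hkn⟩

/-- The circle blown up along the orbits of the end points of the arcs. -/
def blowUp : BlowUp (Option ℤ × ℤ) := S.exists_blowUp.choose

theorem mem_support {x : ℝ} :
    x ∈ S.blowUp.support ↔ ∃ o, ∃ k n : ℤ, x = S.endpoint o + k * α + n := by
  rw [blowUp, S.exists_blowUp.choose_spec]
  simp [Prod.exists]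

theorem invariant : S.blowUp.Invariant α := fun x => by
  rw [S.mem_support, S.mem_support]
  constructor
  · rintro ⟨o, k, n, h⟩
    exact ⟨o, k - 1, n, by push_cast; linarith⟩
  · rintro ⟨o, k, n, h⟩
    exact ⟨o, k + 1, n, by push_cast; linarith⟩

theorem start_mem_support (j : ℤ) : (j * α : ℝ) ∈ S.blowUp.support :=
  S.mem_support.2 ⟨none, j, 0, by simp [endpoint]⟩

theorem end_mem_support {j : ℤ} (hj : j ∈ S.index) :
    (j * α + S.length j : ℝ) ∈ S.blowUp.support :=
  S.mem_support.2 ⟨some j, j, 0, by simp [endpoint, hj, add_comm]⟩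

/-- The union of the arcs, with the starting points and without the end points. -/
def arcs : Set UnitAddCircle :=
  ⋃ j ∈ S.index, ((↑) : ℝ → UnitAddCircle) '' Ico (j * α) (j * α + S.length j)

/-- The union of the open arcs. -/
def openArcs : Set UnitAddCircle :=
  ⋃ j ∈ S.index, ((↑) : ℝ → UnitAddCircle) '' Ioo (j * α) (j * α + S.length j)

/-- The union of the closed arcs. -/
def closedArcs : Set UnitAddCircle :=
  ⋃ j ∈ S.index, ((↑) : ℝ → UnitAddCircle) '' Icc (j * α) (j * α + S.length j)

/-- The union of the arcs, with the end points and without the starting points. -/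
def arcs' : Set UnitAddCircle :=
  ⋃ j ∈ S.index, ((↑) : ℝ → UnitAddCircle) '' Ioc (j * α) (j * α + S.length j)

variable {S} in
theorem coe_mem_arcs {x : ℝ} : (x : UnitAddCircle) ∈ S.arcs ↔
    ∃ j ∈ S.index, ∃ n : ℤ, x + n ∈ Ico (j * α) (j * α + S.length j) := by
  simp only [arcs, mem_iUnion₂, coe_mem_image_coe, exists_prop]

variable {S} in
theorem coe_mem_openArcs {x : ℝ} : (x : UnitAddCircle) ∈ S.openArcs ↔
    ∃ j ∈ S.index, ∃ n : ℤ, x + n ∈ Ioo (j * α) (j * α + S.length j) := by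
  simp only [openArcs, mem_iUnion₂, coe_mem_image_coe, exists_prop]

variable {S} in
theorem coe_mem_closedArcs {x : ℝ} : (x : UnitAddCircle) ∈ S.closedArcs ↔
    ∃ j ∈ S.index, ∃ n : ℤ, x + n ∈ Icc (j * α) (j * α + S.length j) := by
  simp only [closedArcs, mem_iUnion₂, coe_mem_image_coe, exists_prop]

variable {S} in
theorem coe_mem_arcs' {x : ℝ} : (x : UnitAddCircle) ∈ S.arcs' ↔
    ∃ j ∈ S.index, ∃ n : ℤ, x + n ∈ Ioc (j * α) (j * α + S.length j) := by
  simp only [arcs', mem_iUnion₂, coe_mem_image_coe, exists_prop]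

theorem isOpen_openArcs : IsOpen S.openArcs :=
  isOpen_biUnion fun _ _ => BlowUp.isOpenMap_coe _ isOpen_Ioo

theorem isClosed_closedArcs : IsClosed S.closedArcs :=
  S.index.finite_toSet.isClosed_biUnion fun _ _ =>
    (isCompact_Icc.image (AddCircle.continuous_mk' 1)).isClosed

theorem openArcs_subset_arcs : S.openArcs ⊆ S.arcs :=
  iUnion₂_mono fun _ _ => image_mono Ioo_subset_Ico_self

theorem openArcs_subset_arcs' : S.openArcs ⊆ S.arcs' :=
  iUnion₂_mono fun _ _ => image_mono Ioo_subset_Ioc_self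

theorem arcs_subset_closedArcs : S.arcs ⊆ S.closedArcs :=
  iUnion₂_mono fun _ _ => image_mono Ico_subset_Icc_self

theorem arcs'_subset_closedArcs : S.arcs' ⊆ S.closedArcs :=
  iUnion₂_mono fun _ _ => image_mono Ioc_subset_Icc_self

theorem measurableSet_arcs : MeasurableSet S.arcs := by
  refine Finset.measurableSet_biUnion _ fun j hj => ?_
  have : j * α < j * α + S.length j := lt_add_of_pos_right _ (S.length_pos j hj)
  rw [← Ioo_insert_left this, image_insert_eq]
  exact (BlowUp.isOpenMap_coe _ isOpen_Ioo).measurableSet.insert _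

theorem coe_start_mem_closure {j : ℤ} (hj : j ∈ S.index) :
    ((j * α : ℝ) : UnitAddCircle) ∈ closure S.openArcs := by
  have hlt : j * α < j * α + S.length j := lt_add_of_pos_right _ (S.length_pos j hj)
  refine closure_mono (subset_biUnion_of_mem
    (u := fun j : ℤ => ((↑) : ℝ → UnitAddCircle) '' Ioo (j * α) (j * α + S.length j)) hj) ?_
  refine image_closure_subset_closure_image (AddCircle.continuous_mk' 1) ⟨_, ?_, rfl⟩
  rw [closure_Ioo hlt.ne]
  exact left_mem_Icc.2 hlt.le

theorem eq_of_mem {i j m n : ℤ} (hi : i ∈ S.index) (hj : j ∈ S.index) {x : ℝ}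
    (h : |(x + m - i * α) - (x + n - j * α)| < S.gap) : i = j ∧ m = n := by
  have h' : |((j : ℝ) - i) * α + (m - n : ℤ)| < S.gap := by
    convert h using 2
    push_cast
    ring
  obtain ⟨h1, h2⟩ := S.separated j hj i hi _ h'
  exact ⟨h1.symm, by omega⟩

/-! ### Rigidity of the arcs under rotations -/

variable {S} in
-- The rotated starting point lies in some closed arc. Were it not the start of that arc, points
-- just before `j * α` would rotate into the open arc and hence lie in a closed arc themselves,
-- although no arc meets that space.
theorem start_add_eq {r : ℝ} (h1 : ∀ z ∈ S.openArcs, z + (r : UnitAddCircle) ∈ S.closedArcs)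
    (h2 : ∀ z, z + (r : UnitAddCircle) ∈ S.openArcs → z ∈ S.closedArcs) {j : ℤ}
    (hj : j ∈ S.index) : ∃ i ∈ S.index,
      ((j * α + r : ℝ) : UnitAddCircle) = ((i * α : ℝ) : UnitAddCircle) := by
  have hcl : ((j * α : ℝ) : UnitAddCircle) + (r : UnitAddCircle) ∈ S.closedArcs :=
    closure_minimal (t := (· + (r : UnitAddCircle)) ⁻¹' S.closedArcs) h1
      (S.isClosed_closedArcs.preimage (by fun_prop)) (S.coe_start_mem_closure hj)
  rw [← AddCircle.coe_add, coe_mem_closedArcs] at hcl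
  obtain ⟨i, hi, n, hin, hin'⟩ := hcl
  refine ⟨i, hi, ?_⟩
  rcases hin.eq_or_lt with heq | hlt
  · rw [heq]
    exact coe_eq_coe_iff.2 ⟨-n, by push_cast; ring⟩
  exfalso
  have hg := S.gap_pos
  obtain ⟨t, ht0, ht⟩ := exists_between (lt_min (sub_pos.2 hlt) (half_pos hg))
  rw [lt_min_iff] at ht
  have hmem := h2 ((j * α - t : ℝ) : UnitAddCircle) (by
    rw [← AddCircle.coe_add, coe_mem_openArcs]
    exact ⟨i, hi, n, by linarith, by linarith⟩)
  obtain ⟨i', hi', n', h3, h4⟩ := coe_mem_closedArcs.1 hmem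
  have hle := S.length_le i' hi'
  obtain ⟨rfl, h0⟩ := S.eq_of_mem (x := j * α) (m := 0) (n := n') hj hi' (by
    rw [Int.cast_zero, abs_lt]; constructor <;> linarith)
  rw [← h0, Int.cast_zero] at h3
  linarith

/-- Starting points go to starting points, so `r` is a multiple `i - j` of `α` and the finite index
set is mapped into itself by adding `i - j`. Its maximum or minimum rules out a nonzero shift. -/
theorem coe_eq_zero_of_add {r : ℝ}
    (h1 : ∀ z ∈ S.openArcs, z + (r : UnitAddCircle) ∈ S.closedArcs)
    (h2 : ∀ z, z + (r : UnitAddCircle) ∈ S.openArcs → z ∈ S.closedArcs) :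
    (r : UnitAddCircle) = 0 := by
  obtain ⟨j, hj⟩ := S.index_nonempty
  obtain ⟨i, hi, he⟩ := start_add_eq h1 h2 hj
  have hz : ∀ a : ℤ, ((a * α : ℝ) : UnitAddCircle) = a • (α : UnitAddCircle) := fun a => by
    rw [← AddCircle.coe_zsmul, zsmul_eq_mul]
  have hr : (r : UnitAddCircle) = (i - j) • (α : UnitAddCircle) := by
    rw [AddCircle.coe_add, hz, hz] at he
    rw [sub_zsmul, ← he]
    abel
  have hstep : ∀ a ∈ S.index, a + (i - j) ∈ S.index := by
    intro a ha
    obtain ⟨b, hb, hab⟩ := start_add_eq h1 h2 ha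
    rw [AddCircle.coe_add, hz, hz, hr, ← add_zsmul] at hab
    rwa [zsmul_coe_injective S.irrational hab]
  rcases lt_trichotomy (i - j) 0 with hlt | heq | hlt
  · have := S.index.min'_le _ (hstep _ (S.index.min'_mem ⟨j, hj⟩))
    omega
  · rw [hr, heq, zero_zsmul]
  · have := S.index.le_max' _ (hstep _ (S.index.max'_mem ⟨j, hj⟩))
    omega

/-! ### Coding the Denjoy minimal set -/

/-- The Denjoy homeomorphism attached to the arcs. -/
def denjoyHomeo : UnitAddCircle ≃ₜ UnitAddCircle := BlowUp.homeo S.invariant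

/-- The arcs of the blown up circle. -/
def codeSet : Set UnitAddCircle :=
  ⋃ j ∈ S.index, ((↑) : ℝ → UnitAddCircle) ''
    Icc (S.blowUp.upper (j * α)) (S.blowUp.lower (j * α + S.length j))

/-- A slightly larger open version of `codeSet`. -/
def openCodeSet : Set UnitAddCircle :=
  ⋃ j ∈ S.index, ((↑) : ℝ → UnitAddCircle) ''
    Ioo (S.blowUp.lower (j * α)) (S.blowUp.upper (j * α + S.length j))

theorem isClosed_codeSet : IsClosed S.codeSet :=
  S.index.finite_toSet.isClosed_biUnion fun _ _ =>
    (isCompact_Icc.image (AddCircle.continuous_mk' 1)).isClosed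

theorem isOpen_openCodeSet : IsOpen S.openCodeSet :=
  isOpen_biUnion fun _ _ => BlowUp.isOpenMap_coe _ isOpen_Ioo

theorem codeSet_subset : S.codeSet ⊆ S.openCodeSet :=
  iUnion₂_mono fun j hj => image_mono (Icc_subset_Ioo
    (S.blowUp.lower_lt_upper (S.start_mem_support j))
    (S.blowUp.lower_lt_upper (S.end_mem_support hj)))

end ArcSystem

/-! ### Order relations between interval ends, and iterates of the Denjoy homeomorphism on them -/

namespace BlowUp

variable {ι : Type*} (B : BlowUp ι)

theorem upper_le_upper {x y : ℝ} : B.upper x ≤ B.upper y ↔ x ≤ y :=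
  ⟨fun h => le_of_not_gt fun hc =>
    absurd ((B.upper_lt_lower hc).trans_le (B.lower_le_upper x)) (not_lt.2 h),
    fun h => B.upper.monotone h⟩

theorem lower_le_lower {x y : ℝ} : B.lower x ≤ B.lower y ↔ x ≤ y :=
  ⟨fun h => le_of_not_gt fun hc =>
    absurd ((B.lower_le_upper y).trans_lt (B.upper_lt_lower hc)) (not_lt.2 h),
    fun h => B.lower.monotone h⟩

theorem upper_le_lower {x y : ℝ} (hx : x ∈ B.support) : B.upper x ≤ B.lower y ↔ x < y := by
  refine ⟨fun h => lt_of_not_ge fun hc => ?_, fun h => (B.upper_lt_lower h).le⟩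
  linarith [B.lower.monotone hc, B.lower_lt_upper hx]

theorem upper_le_lower' {x y : ℝ} (hy : y ∈ B.support) : B.upper x ≤ B.lower y ↔ x < y := by
  refine ⟨fun h => lt_of_not_ge fun hc => ?_, fun h => (B.upper_lt_lower h).le⟩
  linarith [B.upper.monotone hc, B.lower_lt_upper hy]

theorem le_of_lower_lt_upper {x y : ℝ} (h : B.lower x < B.upper y) : x ≤ y :=
  le_of_not_gt fun hc => absurd (B.upper_lt_lower hc) (not_lt.2 h.le)

theorem homeo_zpow_upper {β : ℝ} (h : B.Invariant β) (x : ℝ) (n : ℤ) :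
    (homeo h ^ n) (B.upper x : UnitAddCircle) = (B.upper (x + n * β) : UnitAddCircle) := by
  have e : ∀ x, homeo h (B.upper x : UnitAddCircle) = (B.upper (x + β) : UnitAddCircle) :=
    fun x => by rw [homeo_coe, moveFun_upper h]
  induction n using Int.induction_on with
  | zero => simp
  | succ k ih =>
    rw [add_comm, zpow_add, zpow_one, Homeomorph.mul_apply, ih, e]
    congr 2; push_cast; ring
  | pred k ih =>
    apply (homeo h).injective
    rw [← Homeomorph.mul_apply, ← zpow_one_add, show (1 + (-(k : ℤ) - 1)) = -k by ring, ih, e]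
    congr 2; push_cast; ring

theorem homeo_zpow_lower {β : ℝ} (h : B.Invariant β) (x : ℝ) (n : ℤ) :
    (homeo h ^ n) (B.lower x : UnitAddCircle) = (B.lower (x + n * β) : UnitAddCircle) := by
  have e : ∀ x, homeo h (B.lower x : UnitAddCircle) = (B.lower (x + β) : UnitAddCircle) :=
    fun x => by rw [homeo_coe, moveFun_lower]
  induction n using Int.induction_on with
  | zero => simp
  | succ k ih =>
    rw [add_comm, zpow_add, zpow_one, Homeomorph.mul_apply, ih, e]
    congr 2; push_cast; ring
  | pred k ih =>
    apply (homeo h).injective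
    rw [← Homeomorph.mul_apply, ← zpow_one_add, show (1 + (-(k : ℤ) - 1)) = -k by ring, ih, e]
    congr 2; push_cast; ring

end BlowUp

/-! ### Codes of points of the Denjoy minimal set -/

namespace ArcSystem

variable {α : ℝ} (S : ArcSystem α)

/-- Right ends see the arcs with their starting points included, left ends with their end points
included: this is how the blow-up separates the two sides of an end point. -/
theorem upper_mem_codeSet {x : ℝ} :
    (S.blowUp.upper x : UnitAddCircle) ∈ S.codeSet ↔ (x : UnitAddCircle) ∈ S.arcs := by
  simp only [codeSet, mem_iUnion₂, coe_mem_image_coe, coe_mem_arcs, exists_prop]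
  refine exists_congr fun j => and_congr_right fun hj => exists_congr fun n => ?_
  rw [← CircleDeg1Lift.map_add_int, mem_Icc, S.blowUp.upper_le_upper,
    S.blowUp.upper_le_lower' (S.end_mem_support hj), mem_Ico]

theorem lower_mem_codeSet {x : ℝ} :
    (S.blowUp.lower x : UnitAddCircle) ∈ S.codeSet ↔ (x : UnitAddCircle) ∈ S.arcs' := by
  simp only [codeSet, mem_iUnion₂, coe_mem_image_coe, coe_mem_arcs', exists_prop]
  refine exists_congr fun j => and_congr_right fun hj => exists_congr fun n => ?_
  rw [← CircleDeg1Lift.map_add_int, mem_Icc, S.blowUp.lower_le_lower,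
    S.blowUp.upper_le_lower (S.start_mem_support j), mem_Ioc]

/-- The closed set and its open enlargement differ only inside inserted gaps. The coding set is
therefore clopen in the minimal set, which makes `code` continuous. -/
theorem mem_codeSet_iff {y : UnitAddCircle} (hy : y ∈ S.blowUp.minimalSet) :
    y ∈ S.codeSet ↔ y ∈ S.openCodeSet := by
  refine ⟨fun h => S.codeSet_subset h, fun h => ?_⟩
  obtain ⟨x, rfl | rfl⟩ := BlowUp.exists_of_mem_minimalSet hy
  · simp only [openCodeSet, mem_iUnion₂, coe_mem_image_coe, exists_prop] at h
    obtain ⟨j, hj, n, h1, h2⟩ := h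
    rw [lower_mem_codeSet, coe_mem_arcs']
    refine ⟨j, hj, n, ?_, ?_⟩
    · rw [← CircleDeg1Lift.map_add_int] at h1
      exact lt_of_not_ge fun hc => absurd (S.blowUp.lower.monotone hc) (not_le.2 h1)
    · rw [← CircleDeg1Lift.map_add_int] at h2
      exact S.blowUp.le_of_lower_lt_upper h2
  · simp only [openCodeSet, mem_iUnion₂, coe_mem_image_coe, exists_prop] at h
    obtain ⟨j, hj, n, h1, h2⟩ := h
    rw [upper_mem_codeSet, coe_mem_arcs]
    refine ⟨j, hj, n, ?_, ?_⟩
    · rw [← CircleDeg1Lift.map_add_int] at h1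
      exact S.blowUp.le_of_lower_lt_upper h1
    · rw [← CircleDeg1Lift.map_add_int] at h2
      exact lt_of_not_ge fun hc => absurd (S.blowUp.upper.monotone hc) (not_le.2 h2)

open Classical in
/-- The itinerary of a point of the blown up circle. -/
def code (y : UnitAddCircle) : Sigma2 :=
  fun i => if (S.denjoyHomeo ^ i) y ∈ S.codeSet then 1 else 0

theorem code_eq_one_iff {y : UnitAddCircle} {i : ℤ} :
    S.code y i = 1 ↔ (S.denjoyHomeo ^ i) y ∈ S.codeSet := by
  classical
  unfold code
  split_ifs with h <;> simp [h]

theorem code_upper_eq_one_iff {x : ℝ} {i : ℤ} :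
    S.code (S.blowUp.upper x : UnitAddCircle) i = 1 ↔
      ((x + i * α : ℝ) : UnitAddCircle) ∈ S.arcs := by
  rw [code_eq_one_iff, denjoyHomeo, BlowUp.homeo_zpow_upper, upper_mem_codeSet]

theorem code_lower_eq_one_iff {x : ℝ} {i : ℤ} :
    S.code (S.blowUp.lower x : UnitAddCircle) i = 1 ↔
      ((x + i * α : ℝ) : UnitAddCircle) ∈ S.arcs' := by
  rw [code_eq_one_iff, denjoyHomeo, BlowUp.homeo_zpow_lower, lower_mem_codeSet]

theorem code_upper (x : ℝ) :
    S.code (S.blowUp.upper x : UnitAddCircle) = itinerary S.arcs α x := by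
  funext i
  rw [fin_two_eq_iff, code_upper_eq_one_iff, itinerary_eq_one_iff, AddCircle.coe_add,
    ← zsmul_eq_mul, AddCircle.coe_zsmul]

theorem shift_code (y : UnitAddCircle) : shift (S.code y) = S.code (S.denjoyHomeo y) := by
  funext i
  rw [fin_two_eq_iff, code_eq_one_iff]
  change S.code y (i + 1) = 1 ↔ _
  rw [code_eq_one_iff, zpow_add, zpow_one, Homeomorph.mul_apply]

theorem isMinimalSet : IsMinimalSet S.denjoyHomeo S.blowUp.minimalSet :=
  BlowUp.isMinimalSet_homeo S.irrational S.invariant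

theorem continuousOn_code : ContinuousOn S.code S.blowUp.minimalSet := by
  rw [continuousOn_iff_continuous_domRestrict, continuous_pi_iff]
  intro i
  have hcl : IsClopen {y : S.blowUp.minimalSet | (S.denjoyHomeo ^ i) y ∈ S.codeSet} := by
    have hc : Continuous fun y : S.blowUp.minimalSet => (S.denjoyHomeo ^ i) y := by fun_prop
    refine ⟨S.isClosed_codeSet.preimage hc, ?_⟩
    have : {y : S.blowUp.minimalSet | (S.denjoyHomeo ^ i) y ∈ S.codeSet} =
        (fun y : S.blowUp.minimalSet => (S.denjoyHomeo ^ i) y) ⁻¹' S.openCodeSet := by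
      ext y
      exact S.mem_codeSet_iff (zpow_mem_of_image_eq S.isMinimalSet.image_eq y.2 i)
    rw [this]
    exact S.isOpen_openCodeSet.preimage hc
  classical
  have := continuous_const.if (f := fun _ : S.blowUp.minimalSet => (1 : Fin 2))
    (g := fun _ => (0 : Fin 2)) (p := fun y => (S.denjoyHomeo ^ i) y ∈ S.codeSet)
    (fun a ha => by rw [hcl.frontier_eq] at ha; exact ha.elim) continuous_const
  convert this using 2 with y
  rw [fin_two_eq_iff]
  change S.code y i = 1 ↔ _
  rw [code_eq_one_iff]
  split_ifs with h <;> simp [h]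

/-- The code of a point over `x` agrees with the itinerary of `x` away from the end points. -/
theorem code_bounds {x : ℝ} {y : UnitAddCircle}
    (hy : y = (S.blowUp.lower x : UnitAddCircle) ∨ y = (S.blowUp.upper x : UnitAddCircle)) (i : ℤ) :
    ((x : UnitAddCircle) + i • (α : UnitAddCircle) ∈ S.openArcs → S.code y i = 1) ∧
      (S.code y i = 1 → (x : UnitAddCircle) + i • (α : UnitAddCircle) ∈ S.closedArcs) := by
  rw [← AddCircle.coe_zsmul, ← AddCircle.coe_add, zsmul_eq_mul]
  rcases hy with rfl | rfl
  · rw [code_lower_eq_one_iff]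
    exact ⟨fun h => S.openArcs_subset_arcs' h, fun h => S.arcs'_subset_closedArcs h⟩
  · rw [code_upper_eq_one_iff]
    exact ⟨fun h => S.openArcs_subset_arcs h, fun h => S.arcs_subset_closedArcs h⟩

/-- A violation at `z` persists on an open set; the orbit of `x` visits it, and at that time the
codes differ. -/
theorem mem_closedArcs_of_code_eq {x x' : ℝ} {y y' : UnitAddCircle}
    (hy : y = (S.blowUp.lower x : UnitAddCircle) ∨ y = (S.blowUp.upper x : UnitAddCircle))
    (hy' : y' = (S.blowUp.lower x' : UnitAddCircle) ∨ y' = (S.blowUp.upper x' : UnitAddCircle))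
    (h : S.code y = S.code y') (z : UnitAddCircle) (hz : z ∈ S.openArcs) :
    z + ((x' - x : ℝ) : UnitAddCircle) ∈ S.closedArcs := by
  by_contra hc
  have hopen : IsOpen (S.openArcs ∩ (· + ((x' - x : ℝ) : UnitAddCircle)) ⁻¹' S.closedArcsᶜ) :=
    S.isOpen_openArcs.inter (S.isClosed_closedArcs.isOpen_compl.preimage (by fun_prop))
  obtain ⟨i, hi1, hi2⟩ := exists_add_zsmul_mem S.irrational (x : UnitAddCircle) hopen ⟨z, hz, hc⟩
  apply hi2
  have := (S.code_bounds hy' i).2 (h ▸ (S.code_bounds hy i).1 hi1)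
  change (x : UnitAddCircle) + i • (α : UnitAddCircle) + ((x' - x : ℝ) : UnitAddCircle) ∈ _
  rwa [AddCircle.coe_sub, add_right_comm, add_sub_cancel]

/-- A point of the support is carried by some iterate onto the start or the end of an arc. At that
time exactly one of the two half-open conventions contains it, by separation of the arcs. -/
theorem code_lower_ne_code_upper {x : ℝ} (hx : x ∈ S.blowUp.support) :
    S.code (S.blowUp.lower x : UnitAddCircle) ≠ S.code (S.blowUp.upper x : UnitAddCircle) := by
  intro he
  have hiff : ∀ i : ℤ, ((x + i * α : ℝ) : UnitAddCircle) ∈ S.arcs' ↔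
      ((x + i * α : ℝ) : UnitAddCircle) ∈ S.arcs := fun i => by
    rw [← code_lower_eq_one_iff, ← code_upper_eq_one_iff, he]
  have hg := S.gap_pos
  have hstart : ∀ k n : ℤ, x = k * α + n → False := by
    intro k n hk
    obtain ⟨j, hj⟩ := S.index_nonempty
    have hpos := S.length_pos j hj
    have h1 := (hiff (j - k)).2 (coe_mem_arcs.2
      ⟨j, hj, -n, by rw [hk]; push_cast; linarith, by rw [hk]; push_cast; linarith⟩)
    obtain ⟨i, hi, m, h2, h3⟩ := coe_mem_arcs'.1 h1
    have hle := S.length_le i hi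
    rw [hk] at h2 h3
    push_cast at h2 h3
    obtain ⟨rfl, h0⟩ := S.eq_of_mem (x := x + ((j - k : ℤ) : ℝ) * α) (m := -n) (n := m) hj hi (by
      rw [hk, abs_lt]; push_cast; constructor <;> linarith)
    rw [← h0] at h2
    push_cast at h2
    linarith
  obtain ⟨o, k, n, hk⟩ := S.mem_support.1 hx
  rcases o with _ | j
  · exact hstart k n (by simpa [endpoint] using hk)
  by_cases hj : j ∈ S.index
  · simp only [endpoint, hj, if_true] at hk
    have hpos := S.length_pos j hj
    have hlej := S.length_le j hj
    have h1 := (hiff (j - k)).1 (coe_mem_arcs'.2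
      ⟨j, hj, -n, by rw [hk]; push_cast; linarith, by rw [hk]; push_cast; linarith⟩)
    obtain ⟨i, hi, m, h2, h3⟩ := coe_mem_arcs.1 h1
    have hle := S.length_le i hi
    rw [hk] at h2 h3
    push_cast at h2 h3
    obtain ⟨rfl, h0⟩ := S.eq_of_mem (x := x + ((j - k : ℤ) : ℝ) * α) (m := -n) (n := m) hj hi (by
      rw [hk, abs_lt]; push_cast; constructor <;> linarith)
    rw [← h0] at h3
    push_cast at h3
    linarith
  · exact hstart k n (by simpa [endpoint, hj] using hk)

/-- Equal codes force equal base points by rigidity of the arcs; the two ends over one base point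
are told apart by `code_lower_ne_code_upper`. -/
theorem injOn_code : InjOn S.code S.blowUp.minimalSet := by
  intro y hy y' hy' h
  obtain ⟨x, hx⟩ := BlowUp.exists_of_mem_minimalSet hy
  obtain ⟨x', hx'⟩ := BlowUp.exists_of_mem_minimalSet hy'
  have h0 := S.coe_eq_zero_of_add (S.mem_closedArcs_of_code_eq hx hx' h) fun z hz => by
    have := S.mem_closedArcs_of_code_eq hx' hx h.symm _ hz
    rwa [add_assoc, ← AddCircle.coe_add, sub_add_sub_cancel, sub_self, AddCircle.coe_zero,
      add_zero] at this
  rw [AddCircle.coe_sub, sub_eq_zero] at h0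
  have hup : (S.blowUp.upper x' : UnitAddCircle) = (S.blowUp.upper x : UnitAddCircle) := by
    rw [← circleMap_coe, h0, circleMap_coe]
  have hlow : (S.blowUp.lower x' : UnitAddCircle) = (S.blowUp.lower x : UnitAddCircle) := by
    rw [← circleMap_coe, h0, circleMap_coe]
  rw [hup, hlow] at hx'
  by_cases hs : x ∈ S.blowUp.support
  · have hne := S.code_lower_ne_code_upper hs
    rcases hx with rfl | rfl <;> rcases hx' with rfl | rfl
    · rfl
    · exact absurd h hne
    · exact absurd h hne.symm
    · rfl
  · rw [S.blowUp.lower_eq_upper hs, or_self] at hx hx'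
    rw [hx, hx']

/-- The set of codes of the points of the Denjoy minimal set. -/
def denjoySet : Set Sigma2 := S.code '' S.blowUp.minimalSet

theorem isDenjoyMinimalSet : IsDenjoyMinimalSet shift S.denjoySet α where
  isCompact := S.isMinimalSet.isCompact.image_of_continuousOn S.continuousOn_code
  image_eq := by
    rw [denjoySet, image_image]
    simp only [shift_code]
    rw [← image_image S.code S.denjoyHomeo, S.isMinimalSet.image_eq]
  conjugate := by
    refine ⟨S.denjoyHomeo, S.blowUp.minimalSet,
      BlowUp.isDenjoyExample_homeo S.irrational S.invariant, S.isMinimalSet, ?_⟩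
    have hY : MapsTo S.denjoyHomeo S.blowUp.minimalSet S.blowUp.minimalSet :=
      BlowUp.mapsTo_homeo S.invariant
    have hD : MapsTo shift S.denjoySet S.denjoySet := by
      rintro _ ⟨y, hy, rfl⟩
      exact ⟨_, hY hy, (S.shift_code y).symm⟩
    have : CompactSpace S.blowUp.minimalSet := isCompact_iff_compactSpace.1 S.isMinimalSet.isCompact
    let e : S.blowUp.minimalSet ≃ S.denjoySet := Equiv.Set.imageOfInjOn _ _ S.injOn_code
    have he : Continuous e := S.continuousOn_code.domRestrict.subtype_mk _
    refine ⟨hD, hY, he.homeoOfEquivCompactToT2.symm, fun s => ?_⟩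
    obtain ⟨y, rfl⟩ := e.surjective s
    apply e.injective
    have e1 : hD.restrict shift S.denjoySet S.denjoySet (e y) =
        e (hY.restrict S.denjoyHomeo S.blowUp.minimalSet S.blowUp.minimalSet y) :=
      Subtype.ext (S.shift_code y)
    change e (e.symm _) = e (hY.restrict _ _ _ (e.symm (e y)))
    rw [e.apply_symm_apply, e.symm_apply_apply, e1]

theorem itinerary_mem_denjoySet (x : UnitAddCircle) : itinerary S.arcs α x ∈ S.denjoySet := by
  obtain ⟨x, rfl⟩ := coe_surjective x
  exact ⟨_, BlowUp.coe_upper_mem x, S.code_upper x⟩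

/-- With half-open arcs every itinerary is the code of a right end, so the image of Haar measure
lives on the Denjoy set without discarding points; uniqueness identifies it. -/
theorem invariantMeasure_denjoySet :
    (invariantMeasure S.denjoySet : Measure Sigma2) =
      (volume : Measure UnitAddCircle).map (itinerary S.arcs α) := by
  obtain ⟨P, hP⟩ := S.isDenjoyMinimalSet.exists_isRotationExtension
  have hm := measurable_itinerary S.measurableSet_arcs α
  have hp := Measure.isProbabilityMeasure_map (μ := (volume : Measure UnitAddCircle))
    hm.aemeasurable
  rw [hP.invariantMeasure_eq (μ := ⟨_, hp⟩), ProbabilityMeasure.coe_mk]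
  refine ⟨measurePreserving_shift_map_itinerary S.measurableSet_arcs _, ?_⟩
  rw [ProbabilityMeasure.coe_mk,
    Measure.map_apply hm S.isDenjoyMinimalSet.isCompact.isClosed.measurableSet,
    eq_univ_of_forall (s := itinerary S.arcs α ⁻¹' S.denjoySet) S.itinerary_mem_denjoySet,
    measure_univ]

end ArcSystem

namespace ArcSystem

variable {α : ℝ} (S : ArcSystem α)

/-! ### Continuous dependence on the arcs -/

theorem coe_mem_arcs_iff_fract {x : ℝ} : (x : UnitAddCircle) ∈ S.arcs ↔
    ∃ j ∈ S.index, Int.fract (x - j * α) < S.length j := by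
  rw [coe_mem_arcs]
  refine exists_congr fun j => and_congr_right fun hj => ⟨?_, fun h => ⟨-⌊x - j * α⌋, ?_⟩⟩
  · rintro ⟨n, h1, h2⟩
    have h3 := S.length_le j hj
    have h4 := S.gap_lt_one
    have : Int.fract (x - j * α) = x + n - j * α := by
      rw [← Int.fract_add_intCast _ n, Int.fract_eq_self.2 ⟨by linarith, by linarith⟩]
      ring
    linarith
  · have h1 := Int.fract_nonneg (x - j * α)
    rw [Int.fract] at h h1
    push_cast
    constructor <;> linarith

/-- The invariant measure of the Denjoy minimal set depends continuously on the lengths of the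
arcs. -/
theorem continuous_invariantMeasure {T : Type*} [TopologicalSpace T] [FirstCountableTopology T]
    {J : Finset ℤ} (S : T → ArcSystem α) (hJ : ∀ t, (S t).index = J)
    (hlen : ∀ j, Continuous fun t => (S t).length j) :
    Continuous fun t => invariantMeasure (S t).denjoySet := by
  refine continuous_iff_continuousAt.2 fun t₀ => ?_
  refine ProbabilityMeasure.tendsto_iff_forall_integral_tendsto.2 fun f => ?_
  have hm : ∀ t, Measurable (itinerary (S t).arcs α) := fun t =>
    measurable_itinerary (S t).measurableSet_arcs α
  have hint : ∀ t, ∫ s, f s ∂(invariantMeasure (S t).denjoySet : Measure Sigma2) =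
      ∫ x, f (itinerary (S t).arcs α x) := fun t => by
    rw [invariantMeasure_denjoySet, integral_map (hm t).aemeasurable (by fun_prop)]
  simp only [hint]
  refine continuousAt_of_dominated (bound := fun _ => ‖f‖)
    (.of_forall fun t => (f.continuous.measurable.comp (hm t)).aestronglyMeasurable)
    (.of_forall fun t => ae_of_all _ fun x => f.norm_coe_le_norm _) (integrable_const _) ?_
  -- The starting points do not move, so only orbits hitting an arc end at parameter `t₀` are
  -- excluded. For all other `x`, each coordinate of the itinerary is locally constant in `t`.
  have hae : ∀ᵐ x : UnitAddCircle, ∀ i : ℤ, ∀ j : ℤ,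
      x ≠ ((j * α + (S t₀).length j : ℝ) : UnitAddCircle) - i • (α : UnitAddCircle) :=
    ae_all_iff.2 fun i => ae_all_iff.2 fun j =>
      measure_eq_zero_iff_ae_notMem.1 (measure_singleton _)
  filter_upwards [hae] with x hx
  refine f.continuous.continuousAt.comp (continuousAt_pi.2 fun i => ?_)
  obtain ⟨z, hz⟩ := coe_surjective (x + i • (α : UnitAddCircle))
  have hev : ∀ᶠ t in 𝓝 t₀, ∀ j ∈ J,
      (Int.fract (z - j * α) < (S t).length j ↔ Int.fract (z - j * α) < (S t₀).length j) := by
    refine (Filter.eventually_all_finset _).2 fun j _ => ?_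
    have hne : Int.fract (z - j * α) ≠ (S t₀).length j := by
      intro he
      apply hx i j
      rw [eq_sub_iff_add_eq, ← hz, ← he, coe_eq_coe_iff]
      exact ⟨⌊z - j * α⌋, by rw [Int.fract]; ring⟩
    rcases hne.lt_or_gt with hlt | hlt
    · filter_upwards [(hlen j).continuousAt.eventually (lt_mem_nhds hlt)] with t ht
      exact iff_of_true ht hlt
    · filter_upwards [(hlen j).continuousAt.eventually (gt_mem_nhds hlt)] with t ht
      exact iff_of_false (not_lt.2 (le_of_lt ht)) (not_lt.2 hlt.le)
  refine (continuousAt_const (y := itinerary (S t₀).arcs α x i)).congr ?_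
  filter_upwards [hev] with t ht
  rw [fin_two_eq_iff, itinerary_eq_one_iff, itinerary_eq_one_iff, ← hz, coe_mem_arcs_iff_fract,
    coe_mem_arcs_iff_fract, hJ, hJ]
  exact exists_congr fun j => and_congr_right fun hj => (ht j hj).symm

/-! ### Recovering the lengths from the invariant measure -/

theorem volume_image_coe_Ico {ℓ : ℝ} (hℓ : ℓ < 1 / 2) :
    volume (((↑) : ℝ → UnitAddCircle) '' Ico 0 ℓ) = ENNReal.ofReal ℓ := by
  have hmeas : MeasurableSet (((↑) : ℝ → UnitAddCircle) '' Ico 0 ℓ) := by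
    rcases le_or_gt ℓ 0 with h | h
    · simp [Ico_eq_empty_of_le h]
    · rw [← Ioo_insert_left h, image_insert_eq]
      exact (BlowUp.isOpenMap_coe _ isOpen_Ioo).measurableSet.insert _
  -- The fundamental interval is based at `-1 / 2` so that `[0, ℓ)` lies inside it.
  rw [AddCircle.add_projection_respects_measure 1 (-1 / 2) hmeas, ← sub_zero ℓ, ← Real.volume_Ico]
  congr 1
  ext x
  rw [sub_zero]
  constructor
  · rintro ⟨hx, h1, h2⟩
    obtain ⟨n, h3, h4⟩ := coe_mem_image_coe.1 hx
    have : |(n : ℝ)| < 1 := by rw [abs_lt]; constructor <;> linarith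
    have h0 : n = 0 := Int.abs_lt_one_iff.1 (by exact_mod_cast this)
    rw [h0, Int.cast_zero, add_zero] at h3 h4
    exact ⟨h3, h4⟩
  · rintro ⟨h1, h2⟩
    exact ⟨⟨x, ⟨h1, h2⟩, rfl⟩, by linarith, by linarith⟩

/-- By `hsep`, the symbol 1 at times 0 and `j` forces the point into arc 0 and its `j`-th rotate
into arc `j`. As these arcs start `j` steps apart, the points in question fill `[0, length j)`, the
shorter of the two. -/
theorem measure_cylinder {j : ℤ} (h0 : 0 ∈ S.index) (hj : j ∈ S.index)
    (hle : S.length j ≤ S.length 0)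
    (hsep : ∀ a ∈ S.index, ∀ b ∈ S.index, ∀ n : ℤ, |(b - a - j) * α + n| < S.gap → a = 0 ∧ b = j) :
    (invariantMeasure S.denjoySet : Measure Sigma2) {s | s 0 = 1 ∧ s j = 1} =
      ENNReal.ofReal (S.length j) := by
  have hmeas : MeasurableSet {s : Sigma2 | s 0 = 1 ∧ s j = 1} :=
    have h : ∀ i : ℤ, MeasurableSet {s : Sigma2 | s i = 1} := fun i =>
      (measurable_pi_apply i : Measurable fun s : Sigma2 => s i) (measurableSet_singleton 1)
    (h 0).inter (h j)
  have hg := S.gap_pos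
  have hg1 := S.gap_lt_one
  have hlj := S.length_le j hj
  rw [invariantMeasure_denjoySet, Measure.map_apply (measurable_itinerary S.measurableSet_arcs α)
    hmeas, ← volume_image_coe_Ico (by linarith)]
  congr 1
  ext x
  obtain ⟨x, rfl⟩ := coe_surjective x
  rw [mem_preimage, mem_ofPred_eq, itinerary_eq_one_iff, itinerary_eq_one_iff, zero_zsmul, add_zero,
    ← AddCircle.coe_zsmul, ← AddCircle.coe_add, coe_mem_arcs, coe_mem_arcs, zsmul_eq_mul,
    coe_mem_image_coe]
  constructor
  · rintro ⟨⟨a, ha, n, h1, h2⟩, b, hb, m, h3, h4⟩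
    have hla := S.length_le a ha
    have hlb := S.length_le b hb
    obtain ⟨rfl, rfl⟩ := hsep a ha b hb (n - m) (by
      rw [abs_lt]; push_cast; constructor <;> linarith)
    obtain ⟨-, rfl⟩ := S.eq_of_mem (x := x) (m := n) (n := m) h0 h0 (by
      rw [Int.cast_zero, abs_lt]
      rw [Int.cast_zero] at h1 h2
      constructor <;> linarith)
    rw [Int.cast_zero] at h1
    exact ⟨n, by linarith, by linarith⟩
  · rintro ⟨n, h1, h2⟩
    refine ⟨⟨0, h0, n, ?_, ?_⟩, j, hj, n, ?_, ?_⟩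
    · rw [Int.cast_zero]; linarith
    · rw [Int.cast_zero]; linarith
    · linarith
    · linarith

end ArcSystem

/-! ### Balls in the space of Denjoy minimal sets -/

/-- The starting times of the arcs in a family with `n` parameters. -/
def oddIndex (n : ℕ) : Finset ℤ :=
  insert 0 ((Finset.univ : Finset (Fin n)).image fun j : Fin n => 2 * ((j : ℕ) : ℤ) + 1)

theorem mem_oddIndex {n : ℕ} {k : ℤ} :
    k ∈ oddIndex n ↔ k = 0 ∨ ∃ j : Fin n, k = 2 * ((j : ℕ) : ℤ) + 1 := by
  simp [oddIndex, eq_comm]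

theorem nonneg_of_mem_oddIndex {n : ℕ} {k : ℤ} (hk : k ∈ oddIndex n) : 0 ≤ k ∧ k ≤ 2 * n := by
  rcases mem_oddIndex.1 hk with rfl | ⟨j, rfl⟩
  · omega
  · have := j.2
    omega

/-- The lengths of the arcs in a family with `n` parameters. -/
def oddLength {n : ℕ} (δ : ℝ) (v : Fin n → ℝ) (k : ℤ) : ℝ :=
  if k = 0 then δ / 2
  -- For `|v j| ≤ 1` this length lies between `δ / 8` and `3 * δ / 8`, hence is positive and below
  -- `δ / 2`.
  else ∑ j : Fin n, if k = 2 * ((j : ℕ) : ℤ) + 1 then δ / 8 * (2 + v j) else 0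

theorem oddLength_zero {n : ℕ} (δ : ℝ) (v : Fin n → ℝ) : oddLength δ v 0 = δ / 2 := if_pos rfl

theorem oddLength_odd {n : ℕ} (δ : ℝ) (v : Fin n → ℝ) (j : Fin n) :
    oddLength δ v (2 * ((j : ℕ) : ℤ) + 1) = δ / 8 * (2 + v j) := by
  rw [oddLength, if_neg (by omega)]
  rw [Finset.sum_eq_single j]
  · rw [if_pos rfl]
  · intro i _ hi
    rw [if_neg]
    intro h
    exact hi (Fin.ext (by omega))
  · simp

theorem continuous_oddLength {n : ℕ} (δ : ℝ) (k : ℤ) :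
    Continuous fun v : Fin n → ℝ => oddLength δ v k := by
  unfold oddLength
  split_ifs
  · exact continuous_const
  · refine continuous_finsetSum _ fun j _ => ?_
    split_ifs <;> fun_prop

/-- A family of arc systems with `n` parameters. -/
def oddArcs {α : ℝ} (hα : Irrational α) {n : ℕ} {δ : ℝ} (hδ : 0 < δ) (hδ1 : δ < 1)
    (hs : IsSeparated α (4 * n) δ) (v : Fin n → ℝ) (hv : ∀ j, |v j| ≤ 1) : ArcSystem α where
  irrational := hα
  gap := δ
  gap_pos := hδ
  gap_lt_one := hδ1
  index := oddIndex n
  index_nonempty := ⟨0, mem_oddIndex.2 (Or.inl rfl)⟩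
  length := oddLength δ v
  length_pos k hk := by
    rcases mem_oddIndex.1 hk with rfl | ⟨j, rfl⟩
    · rw [oddLength_zero]; linarith
    · rw [oddLength_odd]
      have := (abs_le.1 (hv j)).1
      exact mul_pos (by linarith) (by linarith)
  length_le k hk := by
    rcases mem_oddIndex.1 hk with rfl | ⟨j, rfl⟩
    · rw [oddLength_zero]
    · rw [oddLength_odd]
      have := (abs_le.1 (hv j)).2
      nlinarith
  separated i hi j hj m h := by
    have hi' := nonneg_of_mem_oddIndex hi
    have hj' := nonneg_of_mem_oddIndex hj
    obtain ⟨h1, h2⟩ := hs (i - j) m (abs_le.2 ⟨by omega, by omega⟩) (by push_cast; exact h)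
    exact ⟨by omega, h2⟩

theorem measure_cylinder_oddArcs {α : ℝ} (hα : Irrational α) {n : ℕ} {δ : ℝ} (hδ : 0 < δ)
    (hδ1 : δ < 1) (hs : IsSeparated α (4 * n) δ) (v : Fin n → ℝ) (hv : ∀ j, |v j| ≤ 1)
    (j : Fin n) :
    (invariantMeasure (oddArcs hα hδ hδ1 hs v hv).denjoySet : Measure Sigma2)
      {s | s 0 = 1 ∧ s (2 * ((j : ℕ) : ℤ) + 1) = 1} = ENNReal.ofReal (δ / 8 * (2 + v j)) := by
  have h0 : (0 : ℤ) ∈ oddIndex n := mem_oddIndex.2 (Or.inl rfl)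
  have hj : (2 * ((j : ℕ) : ℤ) + 1) ∈ oddIndex n := mem_oddIndex.2 (Or.inr ⟨j, rfl⟩)
  rw [ArcSystem.measure_cylinder _ h0 hj]
  · exact congrArg _ (oddLength_odd δ v j)
  · rw [show (oddArcs hα hδ hδ1 hs v hv).length 0 = δ / 2 from oddLength_zero δ v]
    exact (oddArcs hα hδ hδ1 hs v hv).length_le _ hj
  · intro a ha b hb m hm
    have ha' := nonneg_of_mem_oddIndex ha
    have hb' := nonneg_of_mem_oddIndex hb
    have hj' := nonneg_of_mem_oddIndex hj
    obtain ⟨h1, -⟩ := hs (b - a - (2 * ((j : ℕ) : ℤ) + 1)) m (abs_le.2 ⟨by omega, by omega⟩) (by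
      push_cast at hm ⊢; exact hm)
    -- Here `b - a` is odd and positive. Parity excludes two odd indices, and positivity excludes `b
    -- = 0`.
    rcases mem_oddIndex.1 ha with rfl | ⟨i, rfl⟩
    · exact ⟨rfl, by omega⟩
    · rcases mem_oddIndex.1 hb with rfl | ⟨k, rfl⟩ <;> omega

theorem exists_isEmbedding_closedBall {α : ℝ} (hα : Irrational α) (n : ℕ) :
    ∃ e : Metric.closedBall (0 : EuclideanSpace ℝ (Fin n)) 1 → DenjoySpace α, IsEmbedding e := by
  -- Indices lie in `[0, 2 * n]`, so `4 * n` bounds `b - a - j` in absolute value.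
  obtain ⟨δ, hδ, hδ1, hs⟩ := exists_isSeparated hα (4 * n)
  have hv : ∀ v : Metric.closedBall (0 : EuclideanSpace ℝ (Fin n)) 1, ∀ j, |v.1 j| ≤ 1 :=
    fun v j => (PiLp.norm_apply_le v.1 j).trans (mem_closedBall_zero_iff.1 v.2)
  let S := fun v : Metric.closedBall (0 : EuclideanSpace ℝ (Fin n)) 1 =>
    oddArcs hα hδ hδ1 hs v.1 (hv v)
  have hc : Continuous fun v => invariantMeasure (S v).denjoySet :=
    ArcSystem.continuous_invariantMeasure S (J := oddIndex n) (fun _ => rfl) fun k =>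
      (continuous_oddLength δ k).comp (by fun_prop)
  have hinj : Function.Injective fun v => invariantMeasure (S v).denjoySet := by
    intro v v' h
    refine Subtype.ext (PiLp.ext fun j => ?_)
    have h1 := measure_cylinder_oddArcs hα hδ hδ1 hs v.1 (hv v) j
    have h2 := measure_cylinder_oddArcs hα hδ hδ1 hs v'.1 (hv v') j
    have h3 : invariantMeasure (oddArcs hα hδ hδ1 hs v.1 (hv v)).denjoySet =
      invariantMeasure (oddArcs hα hδ hδ1 hs v'.1 (hv v')).denjoySet := h
    rw [h3, h2] at h1
    have b1 := (abs_le.1 (hv v j)).1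
    have b2 := (abs_le.1 (hv v' j)).1
    rw [ENNReal.ofReal_eq_ofReal_iff (mul_nonneg (by linarith) (by linarith))
      (mul_nonneg (by linarith) (by linarith))] at h1
    have := mul_left_cancel₀ (by positivity) h1
    linarith
  refine ⟨fun v => ⟨(S v).denjoySet, (S v).isDenjoyMinimalSet⟩, ?_⟩
  -- A continuous injection of the compact ball into the Hausdorff space of measures is an
  -- embedding, and the weak topology is induced from that space.
  exact IsEmbedding.of_comp (continuous_induced_rng.2 hc)
    (continuous_induced_dom (f := fun D : DenjoySpace α => invariantMeasure D.1))
    (hc.isClosedEmbedding hinj).isEmbedding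

/-! ### Density of the points of Denjoy minimal sets -/

theorem exists_mem_denjoySpace_of_word {α : ℝ} (hα : Irrational α) (s : Sigma2) (K : ℕ) :
    ∃ D : DenjoySpace α, ∃ t ∈ D.1, ∀ i : ℤ, |i| ≤ K → t i = s i := by
  classical
  obtain ⟨δ, hδ, hδ1, hs⟩ := exists_isSeparated hα (2 * K + 2)
  -- The extra index `K + 1` keeps `J` nonempty when the word has no symbol 1 and lies outside the
  -- window. Differences of indices are at most `2 * K + 2`.
  let J : Finset ℤ := insert (K + 1 : ℤ) ((Finset.Icc (-K : ℤ) K).filter fun i => s i = 1)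
  have hJ : ∀ j ∈ J, |j| ≤ K + 1 := by
    intro j hj
    rcases Finset.mem_insert.1 hj with rfl | hj
    · rw [abs_of_nonneg (by omega)]
    · have := Finset.mem_Icc.1 (Finset.mem_filter.1 hj).1
      exact abs_le.2 ⟨by omega, by omega⟩
  let S : ArcSystem α :=
    { irrational := hα
      gap := δ
      gap_pos := hδ
      gap_lt_one := hδ1
      index := J
      index_nonempty := ⟨_, Finset.mem_insert_self _ _⟩
      length := fun _ => δ / 2
      length_pos := fun _ _ => half_pos hδ
      length_le := fun _ _ => le_rfl
      separated := fun i hi j hj m h => by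
        have hi' := abs_le.1 (hJ i hi)
        have hj' := abs_le.1 (hJ j hj)
        obtain ⟨h1, h2⟩ := hs (i - j) m (abs_le.2 ⟨by omega, by omega⟩) (by push_cast; exact h)
        exact ⟨by omega, h2⟩ }
  refine ⟨⟨S.denjoySet, S.isDenjoyMinimalSet⟩, _, S.itinerary_mem_denjoySet 0, fun i hi => ?_⟩
  rw [fin_two_eq_iff, itinerary_eq_one_iff, zero_add, ← AddCircle.coe_zsmul, zsmul_eq_mul,
    ArcSystem.coe_mem_arcs]
  constructor
  · rintro ⟨j, hj, m, h1, h2⟩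
    change (i * α + m : ℝ) < j * α + δ / 2 at h2
    have hi' := abs_le.1 hi
    have hj' := abs_le.1 (hJ j hj)
    obtain ⟨h3, -⟩ := hs (i - j) m (abs_le.2 ⟨by omega, by omega⟩) (by
      push_cast; rw [abs_lt]; constructor <;> linarith)
    obtain rfl : i = j := by omega
    rcases Finset.mem_insert.1 hj with h | h
    · omega
    · exact (Finset.mem_filter.1 h).2
  · intro h
    refine ⟨i, Finset.mem_insert_of_mem (Finset.mem_filter.2 ⟨Finset.mem_Icc.2 (abs_le.1 hi), h⟩),
      0, ?_⟩
    rw [Int.cast_zero, add_zero]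
    exact left_mem_Ico.2 (lt_add_of_pos_right _ (half_pos hδ))

theorem dense_mem_denjoySpace {α : ℝ} (hα : Irrational α) :
    Dense {s : Sigma2 | ∃ D : DenjoySpace α, s ∈ D.1} := by
  intro s
  refine mem_closure_iff.2 fun V hV hsV => ?_
  obtain ⟨I, u, hu, hIV⟩ := isOpen_pi_iff.1 hV s hsV
  obtain ⟨D, t, ht, hts⟩ := exists_mem_denjoySpace_of_word hα s (I.sup Int.natAbs)
  refine ⟨t, hIV fun i hi => ?_, D, ht⟩
  rw [hts i]
  · exact (hu i hi).2
  · rw [Int.abs_eq_natAbs]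
    exact_mod_cast Finset.le_sup (f := Int.natAbs) hi

end DenjoyShift

end

theorem proposition4p1 (α : ℝ) (hα : Irrational α) :
    -- each of the sets carries exactly one invariant probability measure
    (∀ D : DenjoyShift.DenjoySpace α,
      ∃! μ : MeasureTheory.ProbabilityMeasure DenjoyShift.Sigma2,
        DenjoyShift.IsInvariantOn D.1 μ) ∧
    -- (a)
    (∀ n : ℕ, ∃ e : Metric.closedBall (0 : EuclideanSpace ℝ (Fin n)) 1 →
        DenjoyShift.DenjoySpace α, Topology.IsEmbedding e) ∧
    -- (b)
    Dense {s : DenjoyShift.Sigma2 | ∃ D : DenjoyShift.DenjoySpace α, s ∈ D.1} ∧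
    -- (c)
    (∀ D : DenjoyShift.DenjoySpace α, ∃ U : Set UnitAddCircle,
      DenjoyShift.IsRegularOpen U ∧
      MeasureTheory.volume (frontier U) = 0 ∧
      D.1 = DenjoyShift.Lam U (α : UnitAddCircle) ∧
      (DenjoyShift.invariantMeasure D.1 : MeasureTheory.Measure DenjoyShift.Sigma2) =
        DenjoyShift.lam U (α : UnitAddCircle)) := by
  refine ⟨fun D => ?_, DenjoyShift.exists_isEmbedding_closedBall hα,
    DenjoyShift.dense_mem_denjoySpace hα, fun D => ?_⟩
  · obtain ⟨P, hP⟩ := D.2.exists_isRotationExtension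
    exact hP.existsUnique
  · obtain ⟨P, hP⟩ := D.2.exists_isRotationExtension
    exact ⟨_, hP.isRegularOpen_codingSet, hP.volume_frontier, hP.eq_Lam,
      hP.invariantMeasure_eq_lam⟩
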